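/- Let $n\ge 3$ and let $\mathcal S$ be the space of real symmetric $n\times n$ matrices. Let $U\subset\mathcal S$ be open, invariant under orthogonal conjugation ($O^{-1}UO=U$ for every orthogonal matrix $O$), and such that $U\cap\{M+tN : 0<t<\infty\}$ is convex for every $M\in\mathcal S$ and every positive definite $N\in\mathcal S$. Let $F\in C^1(U)$ be invariant under orthogonal conjugation ($F(O^{-1}MO)=F(M)$ for all $M\in U$ and all orthogonal $O$) and elliptic, i.e. the matrix $\big(\frac{\partial F}{\partial M_{ij}}(M)\big)$ is positive definite for every $M\in U$. For a positive $C^2$ function $u$ put $$A^u=-\frac{2}{n-2}u^{-\frac{n+2}{n-2}}\nabla^2u+\frac{2n}{(n-2)^2}u^{-\frac{2n}{n-2}}\nabla u\otimes\nabla u-\frac{2}{(n-2)^2}u^{-\frac{2n}{n-2}}|\nabla u|^2I .$$ Call $u$ regular at infinity if $|x|^{2-n}u(x/|x|^2)$ extends to a positive $C^2$ function near the origin. By a solution of $F(A^u)=1$ on a set we mean that $A^u(x)\in U$ and $F(A^u(x))=1$ at each of its points. (i) Let $u\in C^2(\mathbb R^n)$ be a positive solution of $F(A^u)=1$ on $\mathbb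 R^n$ that is regular at infinity. Then there are $\bar x\in\mathbb R^n$ and constants $a,b>0$ such that $$u(x)=\left(\frac{a}{1+b^2|x-\bar x|^2}\right)^{\frac{n-2}{2}}\qquad\text{for all }x\in\mathbb R^n.$$ (ii) Let $u\in C^2(\mathbb R^n\setminus\{0\})$ be a positive solution of $F(A^u)=1$ on $\mathbb R^n\setminus\{0\}$ that is regular at infinity, extends to a positive continuous function near the origin, and satisfies $\lim_{x\to0}|x||\nabla u(x)|=0$. Then there are $\bar x\in\mathbb R^n$ and constants $a,b>0$ such that the same formula holds for all $x\in\mathbb R^n\setminus\{0\}$ (hence for the continuous extension of $u$ on all of $\mathbb R^n$). -/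

import Mathlib

open Filter Topology Set
open scoped Matrix

/- Matrices carry the (entrywise sup) norm; the choice of norm is immaterial in finite dimension. -/
attribute [local instance] Matrix.normedAddCommGroup Matrix.normedSpace

namespace ConformalLiouville

noncomputable section

/-- The real vector space of symmetric `n × n` real matrices. -/
abbrev SymMat (n : ℕ) : Submodule ℝ (Matrix (Fin n) (Fin n) ℝ) where
  carrier := {M | M.IsSymm}
  add_mem' := fun ha hb => Matrix.IsSymm.add ha hb
  zero_mem' := Matrix.isSymm_zero
  smul_mem' := fun c _ h => Matrix.IsSymm.smul h c

/-- Orthogonal conjugation `M ↦ O⁻¹ M O` (with `O⁻¹ = Oᵀ`) on symmetric matrices. -/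
def orthConj {n : ℕ} (O : Matrix.orthogonalGroup (Fin n) ℝ) (M : SymMat n) : SymMat n :=
  ⟨(O : Matrix (Fin n) (Fin n) ℝ)ᵀ * (M : Matrix (Fin n) (Fin n) ℝ) *
      (O : Matrix (Fin n) (Fin n) ℝ), by
    have hM : (M : Matrix (Fin n) (Fin n) ℝ)ᵀ = M := M.2
    change (_)ᵀ = _
    rw [Matrix.transpose_mul, Matrix.transpose_mul, Matrix.transpose_transpose, hM,
      Matrix.mul_assoc]⟩

/-- The symmetrized matrix unit `(E_ij + E_ji) / 2`. -/
def symUnit {n : ℕ} (i j : Fin n) : SymMat n :=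
  ⟨(1 / 2 : ℝ) • (Matrix.single i j (1 : ℝ) + Matrix.single j i (1 : ℝ)), by
    change (_)ᵀ = _
    rw [Matrix.transpose_smul, Matrix.transpose_add, Matrix.transpose_single,
      Matrix.transpose_single, add_comm]⟩

/-- The matrix `F_ij(M) = ∂F/∂M_ij (M)` of a function of a symmetric matrix: the symmetric matrix
representing the differential, `dF_M(N) = ∑ i j, F_ij(M) N_ij` for all symmetric `N`. -/
def gradMatrix {n : ℕ} (F : SymMat n → ℝ) (M : SymMat n) : Matrix (Fin n) (Fin n) ℝ :=
  Matrix.of fun i j => fderiv ℝ F M (symUnit i j)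

/-- The conditions on the set `U` of symmetric matrices: open, invariant under orthogonal
conjugation, and with convex intersection with every open ray in a positive definite direction. -/
structure AdmissibleSet {n : ℕ} (U : Set (SymMat n)) : Prop where
  isOpen : IsOpen U
  conj_image : ∀ O : Matrix.orthogonalGroup (Fin n) ℝ, orthConj O '' U = U
  convex_ray : ∀ M N : SymMat n, (N : Matrix (Fin n) (Fin n) ℝ).PosDef →
    Convex ℝ (U ∩ {X | ∃ t : ℝ, 0 < t ∧ X = M + t • N})

/-- The conditions on the function `F` on `U`: of class `C¹`, invariant under orthogonal
conjugation, and elliptic. Values of `F` outside `U` are irrelevant. -/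
structure AdmissibleFun {n : ℕ} (U : Set (SymMat n)) (F : SymMat n → ℝ) : Prop where
  contDiffOn : ContDiffOn ℝ 1 F U
  conj_eq : ∀ O : Matrix.orthogonalGroup (Fin n) ℝ, ∀ M ∈ U, F (orthConj O M) = F M
  elliptic : ∀ M ∈ U, (gradMatrix F M).PosDef

/-- The `i`-th partial derivative of `u` at `x`. -/
def partialD {n : ℕ} (u : EuclideanSpace ℝ (Fin n) → ℝ) (i : Fin n)
    (x : EuclideanSpace ℝ (Fin n)) : ℝ :=
  fderiv ℝ u x (EuclideanSpace.single i 1)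

/-- The conformal Hessian
`A^u = -2/(n-2) u^{-(n+2)/(n-2)} ∇²u + 2n/(n-2)² u^{-2n/(n-2)} ∇u ⊗ ∇u
  - 2/(n-2)² u^{-2n/(n-2)} |∇u|² I`. -/
def confHess {n : ℕ} (u : EuclideanSpace ℝ (Fin n) → ℝ) (x : EuclideanSpace ℝ (Fin n)) :
    Matrix (Fin n) (Fin n) ℝ :=
  (-(2 / ((n : ℝ) - 2)) * u x ^ (-(((n : ℝ) + 2) / ((n : ℝ) - 2)))) •
      Matrix.of (fun i j => partialD (partialD u j) i x)
    + (2 * (n : ℝ) / ((n : ℝ) - 2) ^ 2 * u x ^ (-(2 * (n : ℝ) / ((n : ℝ) - 2)))) •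
      Matrix.of (fun i j => partialD u i x * partialD u j x)
    - (2 / ((n : ℝ) - 2) ^ 2 * u x ^ (-(2 * (n : ℝ) / ((n : ℝ) - 2))) *
        ∑ k, partialD u k x ^ 2) • (1 : Matrix (Fin n) (Fin n) ℝ)

/-- `F(A^u) = 1` on `Ω`; this includes that `A^u(x)` lies in the domain `U` of `F`. -/
def SolvesOn {n : ℕ} (U : Set (SymMat n)) (F : SymMat n → ℝ)
    (u : EuclideanSpace ℝ (Fin n) → ℝ) (Ω : Set (EuclideanSpace ℝ (Fin n))) : Prop :=
  ∀ x ∈ Ω, ∃ M ∈ U, (M : Matrix (Fin n) (Fin n) ℝ) = confHess u x ∧ F M = 1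

/-- `u` is regular at infinity: `|x|^{2-n} u(x/|x|²)` extends to a positive `C²` function near
the origin. -/
def RegularAtInfinity {n : ℕ} (u : EuclideanSpace ℝ (Fin n) → ℝ) : Prop :=
  ∃ r : ℝ, 0 < r ∧ ∃ v : EuclideanSpace ℝ (Fin n) → ℝ,
    ContDiffOn ℝ 2 v (Metric.ball 0 r) ∧ (∀ x ∈ Metric.ball 0 r, 0 < v x) ∧
    ∀ x ∈ Metric.ball 0 r, x ≠ 0 → v x = ‖x‖ ^ (2 - (n : ℝ)) * u ((1 / ‖x‖ ^ 2) • x)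

/-- `u`, given away from the origin, extends to a positive continuous function near the origin. -/
def ExtendsContinuouslyPos {n : ℕ} (u : EuclideanSpace ℝ (Fin n) → ℝ) : Prop :=
  ∃ r : ℝ, 0 < r ∧ ∃ w : EuclideanSpace ℝ (Fin n) → ℝ,
    ContinuousOn w (Metric.ball 0 r) ∧ (∀ x ∈ Metric.ball 0 r, 0 < w x) ∧
    ∀ x ∈ Metric.ball 0 r, x ≠ 0 → w x = u x

end

end ConformalLiouville

/-!
In the variable `ξ = u ^ (-2 / (n - 2))` the conformal Hessian is `ξ ∇²ξ - |∇ξ|² / 2 I`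
(`schouten`), and a bubble is a positive quadratic polynomial with leading part `α |x|²`. The Kelvin
transform `ξ ↦ (|y|² / l²) ξ(l² y / |y|²)` conjugates this matrix by a reflection
(`schouten_kelvin`), so it maps solutions to solutions.

The engine is the method of moving spheres (`le_kelvin`): if `ξ → β` at the centre of the spheres
with `|y| |∇ξ| → 0`, and `ξ ~ α |y|²` at infinity, then `ξ` lies below its Kelvin transform outside
the sphere of radius `l` for all `l² ≤ β / α`. Small spheres work because `ξ(ty) / t` decreases near
the centre. For `l² < β / α` the inequality is strict near infinity, and elsewhere touching is
excluded by a boundary point lemma (`false_of_touching`), applied at a contact point of maximal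
norm or at a point of the sphere where `ξ(ty) / t` is critical. That lemma compares `ξ` with a
larger solution through a barrier. It uses the ellipticity of `F` only near the value of the
conformal Hessian of the larger function at the point of contact, and it does not use the equation
for the smaller function there. Hence one point where the equation may fail is harmless, as long as
the spheres do not sweep over it. This matters because the conformal Hessian of the inverted
solution may leave `U` at the point that represents infinity.

Moving spheres about the origin, from the origin and from infinity, give opposite inequalities at
the same critical radius, so `ξ` is invariant under a Kelvin transform (`eq_kelvin`); in particular
it is as smooth at the origin as it is at infinity. For an arbitrary centre `x`, moving from `x` or
from infinity, according to the position of the origin, yields an inequality at the critical radius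
that is an equality at infinity. Equality of the first derivatives there reads
`∇ξ(x) = 2 α x + g` with `α` and `g` independent of `x` (`fderiv_eq_of_solves`), so `ξ` is a
quadratic polynomial.
-/

namespace ConformalLiouville

noncomputable section

variable {n : ℕ} {U : Set (SymMat n)} {F : SymMat n → ℝ}

/-! ### Symmetric matrices as quadratic forms -/

/-- The quadratic form `a ↦ aᵀ M a` of a symmetric matrix. -/
def quad (M : SymMat n) (a : EuclideanSpace ℝ (Fin n)) : ℝ :=
  ∑ i, ∑ j, (M : Matrix (Fin n) (Fin n) ℝ) i j * a i * a j

/-- The rank one matrix `ν νᵀ`. -/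
def rankOne (ν : EuclideanSpace ℝ (Fin n)) : SymMat n :=
  ⟨Matrix.of fun i j => ν i * ν j, by ext i j; simp [mul_comm]⟩

/-- The identity matrix. -/
def idMat : SymMat n := ⟨1, Matrix.isSymm_one⟩

lemma quad_add (M N : SymMat n) (a : EuclideanSpace ℝ (Fin n)) :
    quad (M + N) a = quad M a + quad N a := by
  simp [quad, add_mul, Finset.sum_add_distrib]

lemma quad_smul (c : ℝ) (M : SymMat n) (a : EuclideanSpace ℝ (Fin n)) :
    quad (c • M) a = c * quad M a := by
  simp [quad, mul_assoc, Finset.mul_sum]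

lemma quad_sub (M N : SymMat n) (a : EuclideanSpace ℝ (Fin n)) :
    quad (M - N) a = quad M a - quad N a := by
  simp [quad, sub_mul, Finset.sum_sub_distrib]

lemma quad_rankOne (ν a : EuclideanSpace ℝ (Fin n)) :
    quad (rankOne ν) a = inner ℝ ν a ^ 2 := by
  simp only [quad, rankOne, PiLp.inner_apply, sq, Finset.sum_mul_sum, Matrix.of_apply]
  refine Finset.sum_congr rfl fun i _ => Finset.sum_congr rfl fun j _ => ?_
  simp
  ring

lemma quad_idMat (a : EuclideanSpace ℝ (Fin n)) : quad idMat a = ‖a‖ ^ 2 := by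
  rw [EuclideanSpace.real_norm_sq_eq]
  simp [quad, idMat, Matrix.one_apply, sq]

lemma quad_eq_dotProduct (M : SymMat n) (a : EuclideanSpace ℝ (Fin n)) :
    quad M a = (⇑a) ⬝ᵥ ((M : Matrix (Fin n) (Fin n) ℝ) *ᵥ (⇑a)) := by
  simp only [quad, dotProduct, Matrix.mulVec, Finset.mul_sum]
  refine Finset.sum_congr rfl fun i _ => Finset.sum_congr rfl fun j _ => ?_
  ring

lemma posSemidef_of_quad {M : SymMat n} (h : ∀ a, 0 ≤ quad M a) :
    (M : Matrix (Fin n) (Fin n) ℝ).PosSemidef := by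
  refine Matrix.PosSemidef.of_dotProduct_mulVec_nonneg ?_ fun x => ?_
  · rw [Matrix.IsHermitian, Matrix.conjTranspose_eq_transpose_of_trivial]; exact M.2
  · have := h (WithLp.toLp 2 x)
    rwa [quad_eq_dotProduct] at this

lemma posDef_of_quad {M : SymMat n} (h : ∀ a, a ≠ 0 → 0 < quad M a) :
    (M : Matrix (Fin n) (Fin n) ℝ).PosDef := by
  refine Matrix.PosDef.of_dotProduct_mulVec_pos ?_ fun x hx => ?_
  · rw [Matrix.IsHermitian, Matrix.conjTranspose_eq_transpose_of_trivial]; exact M.2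
  · have := h (WithLp.toLp 2 x) (by simpa using hx)
    rwa [quad_eq_dotProduct] at this

lemma quad_polarization (M : SymMat n) (i j : Fin n) :
    quad M (EuclideanSpace.single i 1 + EuclideanSpace.single j 1)
      = quad M (EuclideanSpace.single i 1) + quad M (EuclideanSpace.single j 1)
        + 2 * (M : Matrix (Fin n) (Fin n) ℝ) i j := by
  have hs : (M : Matrix (Fin n) (Fin n) ℝ) j i = (M : Matrix (Fin n) (Fin n) ℝ) i j :=
    congrFun (congrFun M.2 i) j
  simp [quad, mul_add, Finset.sum_add_distrib, hs]
  ring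

lemma eq_of_quad_eq {M N : SymMat n} (h : ∀ a, quad M a = quad N a) : M = N := by
  ext i j
  have h1 := quad_polarization M i j
  have h2 := quad_polarization N i j
  rw [h, h, h] at h1
  linarith

lemma continuous_rankOne : Continuous (rankOne : EuclideanSpace ℝ (Fin n) → SymMat n) := by
  refine Continuous.subtype_mk ?_ _
  refine continuous_pi fun i => continuous_pi fun j => ?_
  simp only [Matrix.of_apply]
  fun_prop

lemma quad_orthConj (O : Matrix.orthogonalGroup (Fin n) ℝ) (M : SymMat n)
    (a : EuclideanSpace ℝ (Fin n)) :
    quad (orthConj O M) a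
      = quad M (WithLp.toLp 2 ((O : Matrix (Fin n) (Fin n) ℝ) *ᵥ (⇑a))) := by
  rw [quad_eq_dotProduct, quad_eq_dotProduct]
  simp only [orthConj]
  rw [← Matrix.mulVec_mulVec, ← Matrix.mulVec_mulVec, Matrix.dotProduct_mulVec,
    Matrix.vecMul_transpose]

lemma clm_apply_eq_sum (L : SymMat n →L[ℝ] ℝ) (N : SymMat n) :
    L N = ∑ i, ∑ j, (N : Matrix (Fin n) (Fin n) ℝ) i j * L (symUnit i j) := by
  have : N = ∑ i, ∑ j, (N : Matrix (Fin n) (Fin n) ℝ) i j • symUnit i j := by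
    ext p q
    have hT : (N : Matrix (Fin n) (Fin n) ℝ) q p = (N : Matrix (Fin n) (Fin n) ℝ) p q :=
      congrFun (congrFun N.2 p) q
    simp [symUnit, Matrix.sum_apply, Matrix.single_apply, Finset.sum_add_distrib, ite_and,
      hT]
    ring
  conv_lhs => rw [this]
  simp [map_sum]

/-- Pairing of a positive definite with a nonzero positive semidefinite matrix. -/
lemma sum_mul_pos_of_posDef {G P : Matrix (Fin n) (Fin n) ℝ} (hG : G.PosDef) (hP : P.PosSemidef)
    (hP0 : P ≠ 0) : 0 < ∑ i, ∑ j, P i j * G i j := by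
  obtain ⟨B, rfl⟩ : ∃ B : Matrix (Fin n) (Fin n) ℝ, P = Bᴴ * B := by
    open scoped MatrixOrder in
    refine ⟨CFC.sqrt P, ?_⟩
    rw [(Matrix.nonneg_iff_posSemidef.mp (CFC.sqrt_nonneg P)).isHermitian.eq, CFC.sqrt_mul_sqrt_self P hP.nonneg]
  have key : ∑ i, ∑ j, (Bᴴ * B) i j * G i j = ∑ k, (B k ⬝ᵥ (G *ᵥ B k)) := by
    simp only [dotProduct, Matrix.mulVec, Matrix.mul_apply, Finset.sum_mul, Finset.mul_sum,
      Matrix.conjTranspose_apply, star_trivial]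
    refine ((Finset.sum_congr rfl fun i _ => Finset.sum_comm).trans Finset.sum_comm).trans ?_
    refine Finset.sum_congr rfl fun k _ => Finset.sum_congr rfl fun i _ =>
      Finset.sum_congr rfl fun j _ => ?_
    ring
  rw [key]
  have hB : B ≠ 0 := by rintro rfl; simp at hP0
  obtain ⟨k, hk⟩ : ∃ k, B k ≠ 0 := by
    by_contra! h
    exact hB (funext h)
  have hnn : ∀ v : Fin n → ℝ, 0 ≤ v ⬝ᵥ (G *ᵥ v) := fun v => by
    simpa using hG.posSemidef.dotProduct_mulVec_nonneg v
  exact Finset.sum_pos' (fun k _ => hnn _)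
    ⟨k, Finset.mem_univ _, by simpa using hG.dotProduct_mulVec_pos hk⟩

/-! ### Monotonicity of an elliptic function of a symmetric matrix -/

lemma AdmissibleFun.contDiffAt (hU : AdmissibleSet U) (hF : AdmissibleFun U F) {M : SymMat n}
    (hM : M ∈ U) : ContDiffAt ℝ 1 F M :=
  hF.contDiffOn.contDiffAt (hU.isOpen.mem_nhds hM)

lemma AdmissibleFun.differentiableAt (hU : AdmissibleSet U) (hF : AdmissibleFun U F)
    {M : SymMat n} (hM : M ∈ U) : DifferentiableAt ℝ F M :=
  (hF.contDiffAt hU hM).differentiableAt (by norm_num)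

lemma AdmissibleFun.fderiv_pos (hF : AdmissibleFun U F) {M P : SymMat n} (hM : M ∈ U)
    (hP : ∀ a, 0 ≤ quad P a) (hP0 : P ≠ 0) : 0 < fderiv ℝ F M P := by
  rw [clm_apply_eq_sum]
  exact sum_mul_pos_of_posDef (hF.elliptic M hM) (posSemidef_of_quad hP)
    (fun h => hP0 (Subtype.ext h))

lemma hasDerivAt_line {M D : SymMat n} {t : ℝ} (h : DifferentiableAt ℝ F (M + t • D)) :
    HasDerivAt (fun s : ℝ => F (M + s • D)) (fderiv ℝ F (M + t • D) D) t := by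
  have h1 : HasDerivAt (fun s : ℝ => M + s • D) D t := by
    have h2 := ((hasDerivAt_id t).smul_const D).const_add M
    rw [one_smul] at h2
    exact h2
  exact h.hasFDerivAt.comp_hasDerivAt t h1

lemma AdmissibleFun.le_add_of_posDef (hU : AdmissibleSet U) (hF : AdmissibleFun U F)
    {M D : SymMat n} (hM : M ∈ U) (hMD : M + D ∈ U) (hD : ∀ a, a ≠ 0 → 0 < quad D a) :
    F M ≤ F (M + D) := by
  have hDnn : ∀ a, 0 ≤ quad D a := fun a => by
    rcases eq_or_ne a 0 with rfl | h
    · simp [quad]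
    · exact (hD a h).le
  rcases eq_or_ne D 0 with rfl | hD0
  · simp
  -- The ray based at `M - D` contains `M` at time `1` and `M + D` at time `2`.
  have hconv := hU.convex_ray (M - D) D (posDef_of_quad hD)
  have hseg : ∀ t ∈ Icc (0 : ℝ) 1, M + t • D ∈ U := by
    intro t ht
    have h1 : M ∈ U ∩ {X | ∃ t : ℝ, 0 < t ∧ X = (M - D) + t • D} := ⟨hM, 1, one_pos, by simp⟩
    have h2 : M + D ∈ U ∩ {X | ∃ t : ℝ, 0 < t ∧ X = (M - D) + t • D} :=
      ⟨hMD, 2, two_pos, by module⟩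
    have := hconv h1 h2 (sub_nonneg.mpr ht.2) ht.1 (by ring)
    convert this.1 using 1
    module
  have hd : ∀ t ∈ Icc (0 : ℝ) 1, HasDerivAt (fun s : ℝ => F (M + s • D))
      (fderiv ℝ F (M + t • D) D) t := fun t ht =>
    hasDerivAt_line (hF.differentiableAt hU (hseg t ht))
  have hmono : MonotoneOn (fun s : ℝ => F (M + s • D)) (Icc 0 1) := by
    refine monotoneOn_of_deriv_nonneg (convex_Icc 0 1)
      (fun t ht => (hd t ht).continuousAt.continuousWithinAt)
      (fun t ht => (hd t (interior_subset ht)).differentiableAt.differentiableWithinAt)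
      fun t ht => ?_
    rw [(hd t (interior_subset ht)).deriv]
    exact (hF.fderiv_pos (hseg t (interior_subset ht)) hDnn hD0).le
  simpa using hmono (by simp : (0 : ℝ) ∈ Icc (0 : ℝ) 1) (by simp) zero_le_one

lemma tendsto_add_smul (N D : SymMat n) :
    Tendsto (fun ε : ℝ => N + ε • D) (𝓝[>] 0) (𝓝 N) := by
  have : ContinuousAt (fun ε : ℝ => N + ε • D) 0 := by fun_prop
  have h := this.tendsto
  simp only [zero_smul, add_zero] at h
  exact h.mono_left nhdsWithin_le_nhds

/-- An elliptic function is monotone for the order of quadratic forms. The segment from `M` to `N`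
need not lie in `U`, so `N` is approached along `N + ε I`, which differs from `M` by a positive
definite matrix. -/
lemma AdmissibleFun.mono (hU : AdmissibleSet U) (hF : AdmissibleFun U F)
    {M N : SymMat n} (hM : M ∈ U) (hN : N ∈ U) (h : ∀ a, quad M a ≤ quad N a) : F M ≤ F N := by
  have ht := tendsto_add_smul N idMat
  have hlim : Tendsto (fun ε : ℝ => F (N + ε • idMat)) (𝓝[>] 0) (𝓝 (F N)) :=
    (hF.differentiableAt hU hN).continuousAt.tendsto.comp ht
  refine ge_of_tendsto hlim ?_
  filter_upwards [ht (hU.isOpen.mem_nhds hN), self_mem_nhdsWithin] with ε hε hpos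
  have hpos : 0 < ε := hpos
  have h2 : M + (N + ε • idMat - M) = N + ε • idMat := by abel
  have := hF.le_add_of_posDef hU (M := M) (D := N + ε • idMat - M) hM (by rw [h2]; exact hε) ?_
  · rwa [h2] at this
  · intro a ha
    rw [quad_sub, quad_add, quad_smul, quad_idMat]
    have : 0 < ‖a‖ := norm_pos_iff.mpr ha
    have := h a
    have : 0 < ε * ‖a‖ ^ 2 := by positivity
    linarith

/-- Near a matrix where the derivative of `F` in the direction `D₀` is positive, `F` decreases
strictly along the opposites of all nearby directions. -/
lemma AdmissibleFun.eventually_lt (hU : AdmissibleSet U) (hF : AdmissibleFun U F)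
    {M₀ D₀ : SymMat n} (hM : M₀ ∈ U) (hD : 0 < fderiv ℝ F M₀ D₀) :
    ∀ᶠ p : SymMat n × SymMat n × ℝ in 𝓝 (M₀, D₀, 0), p.1 - p.2.2 • p.2.1 ∈ U ∧
      (0 < p.2.2 → F (p.1 - p.2.2 • p.2.1) < F p.1) := by
  have hcont : ContinuousAt (fun q : SymMat n × SymMat n => fderiv ℝ F q.1 q.2) (M₀, D₀) := by
    have h1 : ContinuousAt (fderiv ℝ F) M₀ :=
      ((hF.contDiffAt hU hM).fderiv_right (m := 0) (by norm_num)).continuousAt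
    exact (h1.comp (f := Prod.fst) (x := (M₀, D₀)) continuousAt_fst).clm_apply continuousAt_snd
  have hev : ∀ᶠ q : SymMat n × SymMat n in 𝓝 (M₀, D₀), q.1 ∈ U ∧ 0 < fderiv ℝ F q.1 q.2 :=
    (continuousAt_fst.eventually (hU.isOpen.mem_nhds hM)).and (hcont.eventually (lt_mem_nhds hD))
  obtain ⟨ρ, hρ, hball⟩ := Metric.eventually_nhds_iff_ball.mp hev
  have hb : ∀ X ∈ Metric.ball M₀ ρ, ∀ D ∈ Metric.ball D₀ ρ, X ∈ U ∧ 0 < fderiv ℝ F X D := by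
    intro X hX D hD
    exact hball (X, D) (by rw [← ball_prod_same]; exact ⟨hX, hD⟩)
  have hc : ContinuousAt (fun p : SymMat n × SymMat n × ℝ => p.1 - p.2.2 • p.2.1) (M₀, D₀, 0) := by
    fun_prop
  have e1 : ∀ᶠ p : SymMat n × SymMat n × ℝ in 𝓝 (M₀, D₀, 0), p.1 ∈ Metric.ball M₀ ρ :=
    continuousAt_fst.eventually (Metric.ball_mem_nhds _ hρ)
  have e2 : ∀ᶠ p : SymMat n × SymMat n × ℝ in 𝓝 (M₀, D₀, 0), p.2.1 ∈ Metric.ball D₀ ρ :=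
    (continuousAt_fst.comp continuousAt_snd).eventually (Metric.ball_mem_nhds _ hρ)
  have e3 : ∀ᶠ p : SymMat n × SymMat n × ℝ in 𝓝 (M₀, D₀, 0),
      p.1 - p.2.2 • p.2.1 ∈ Metric.ball M₀ ρ :=
    by
    refine hc.eventually_mem ?_
    rw [zero_smul, sub_zero]
    exact Metric.ball_mem_nhds _ hρ
  filter_upwards [e1, e2, e3] with p h1 h2 h3
  refine ⟨(hb _ h3 _ h2).1, fun hpos => ?_⟩
  obtain ⟨X, D, ε⟩ := p
  simp only at h1 h2 h3 hpos ⊢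
  have hX : X - ε • D + ε • D = X := sub_add_cancel _ _
  generalize X - ε • D = Y at h3 hX ⊢
  subst hX
  have hseg : ∀ t ∈ Icc (0 : ℝ) ε, Y + t • D ∈ Metric.ball M₀ ρ := by
    intro t ht
    have := (convex_ball M₀ ρ) h3 h1 (a := 1 - t / ε) (b := t / ε)
      (sub_nonneg.mpr ((div_le_one hpos).mpr ht.2)) (div_nonneg ht.1 hpos.le) (by ring)
    convert this using 1
    have : t • D = (t / ε) • (ε • D) := by rw [smul_smul, div_mul_cancel₀ _ hpos.ne']
    rw [this]; module
  have hd : ∀ t ∈ Icc (0 : ℝ) ε, HasDerivAt (fun s : ℝ => F (Y + s • D))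
      (fderiv ℝ F (Y + t • D) D) t := fun t ht =>
    hasDerivAt_line (hF.differentiableAt hU (hb _ (hseg t ht) _ h2).1)
  have hmono : StrictMonoOn (fun s : ℝ => F (Y + s • D)) (Icc 0 ε) := by
    refine strictMonoOn_of_deriv_pos (convex_Icc 0 ε)
      (fun t ht => (hd t ht).continuousAt.continuousWithinAt) fun t ht => ?_
    rw [(hd t (interior_subset ht)).deriv]
    exact (hb _ (hseg t (interior_subset ht)) _ h2).2
  simpa using hmono (by simp [hpos.le] : (0 : ℝ) ∈ Icc (0 : ℝ) ε) (by simp [hpos.le]) hpos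

/-! ### The conformal Hessian in the variable `ξ = u ^ (-2 / (n - 2))` -/

/-- The symmetric matrix of a bilinear form, symmetrized so that it is symmetric without any
assumption on the form. -/
def symForm (B : EuclideanSpace ℝ (Fin n) →L[ℝ] EuclideanSpace ℝ (Fin n) →L[ℝ] ℝ) : SymMat n :=
  ⟨Matrix.of fun i j => (B (EuclideanSpace.single i 1) (EuclideanSpace.single j 1)
    + B (EuclideanSpace.single j 1) (EuclideanSpace.single i 1)) / 2, by
    ext i j; simp [add_comm]⟩

lemma quad_symForm (B : EuclideanSpace ℝ (Fin n) →L[ℝ] EuclideanSpace ℝ (Fin n) →L[ℝ] ℝ)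
    (a : EuclideanSpace ℝ (Fin n)) : quad (symForm B) a = B a a := by
  have ha : a = ∑ i, a i • EuclideanSpace.single i (1 : ℝ) := by
    ext j
    simp [Finset.sum_apply, Pi.single_apply]
  have h1 : B a a = ∑ i, ∑ j, a i * a j
      * B (EuclideanSpace.single i 1) (EuclideanSpace.single j 1) := by
    conv_lhs => rw [ha]
    simp only [map_sum, map_smul, _root_.sum_apply, _root_.smul_apply,
      smul_eq_mul, Finset.mul_sum]
    rw [Finset.sum_comm]
    refine Finset.sum_congr rfl fun i _ => Finset.sum_congr rfl fun j _ => ?_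
    ring
  have h2 : B a a = ∑ i, ∑ j, a i * a j
      * B (EuclideanSpace.single j 1) (EuclideanSpace.single i 1) := by
    rw [h1, Finset.sum_comm]
    refine Finset.sum_congr rfl fun i _ => Finset.sum_congr rfl fun j _ => ?_
    ring
  have h3 : B a a = (B a a + B a a) / 2 := by ring
  rw [h3]
  nth_rewrite 1 [h1]
  rw [h2, ← Finset.sum_add_distrib, Finset.sum_div]
  refine Finset.sum_congr rfl fun i _ => ?_
  rw [← Finset.sum_add_distrib, Finset.sum_div]
  refine Finset.sum_congr rfl fun j _ => ?_
  simp only [symForm, Matrix.of_apply]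
  ring

lemma continuous_symForm : Continuous (symForm (n := n)) := by
  refine Continuous.subtype_mk ?_ _
  have h : ∀ a b, Continuous fun B : EuclideanSpace ℝ (Fin n) →L[ℝ]
      EuclideanSpace ℝ (Fin n) →L[ℝ] ℝ => B a b := fun a b =>
    (continuous_id.clm_apply continuous_const).clm_apply continuous_const
  refine continuous_pi fun i => continuous_pi fun j => ?_
  simp only [Matrix.of_apply]
  exact ((h _ _).add (h _ _)).div_const 2

/-- The matrix `ξ ∇²ξ - |∇ξ|² / 2 I`. It equals the conformal Hessian `A^u` of `u` when
`ξ = u ^ (-2 / (n - 2))`. -/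
def schouten (ξ : EuclideanSpace ℝ (Fin n) → ℝ) (x : EuclideanSpace ℝ (Fin n)) : SymMat n :=
  ξ x • symForm (fderiv ℝ (fderiv ℝ ξ) x) - (‖fderiv ℝ ξ x‖ ^ 2 / 2) • idMat

lemma quad_schouten (ξ : EuclideanSpace ℝ (Fin n) → ℝ) (x a : EuclideanSpace ℝ (Fin n)) :
    quad (schouten ξ x) a
      = ξ x * fderiv ℝ (fderiv ℝ ξ) x a a - ‖fderiv ℝ ξ x‖ ^ 2 / 2 * ‖a‖ ^ 2 := by
  rw [schouten, quad_sub, quad_smul, quad_smul, quad_symForm, quad_idMat]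

lemma contDiffAt_fderiv {ξ : EuclideanSpace ℝ (Fin n) → ℝ} {x : EuclideanSpace ℝ (Fin n)}
    (h : ContDiffAt ℝ 2 ξ x) : ContDiffAt ℝ 1 (fderiv ℝ ξ) x :=
  h.fderiv_right (m := 1) (by norm_num)

lemma hasFDerivAt_fderiv {ξ : EuclideanSpace ℝ (Fin n) → ℝ} {x : EuclideanSpace ℝ (Fin n)}
    (h : ContDiffAt ℝ 2 ξ x) : HasFDerivAt (fderiv ℝ ξ) (fderiv ℝ (fderiv ℝ ξ) x) x :=
  ((contDiffAt_fderiv h).differentiableAt (by norm_num)).hasFDerivAt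

lemma continuousAt_fderiv_fderiv {ξ : EuclideanSpace ℝ (Fin n) → ℝ}
    {x : EuclideanSpace ℝ (Fin n)} (h : ContDiffAt ℝ 2 ξ x) :
    ContinuousAt (fderiv ℝ (fderiv ℝ ξ)) x :=
  ((contDiffAt_fderiv h).fderiv_right (m := 0) (by norm_num)).continuousAt

lemma continuousAt_schouten {ξ : EuclideanSpace ℝ (Fin n) → ℝ} {x : EuclideanSpace ℝ (Fin n)}
    (h : ContDiffAt ℝ 2 ξ x) : ContinuousAt (schouten ξ) x := by
  have h1 := h.continuousAt
  have h2 := (contDiffAt_fderiv h).continuousAt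
  have h3 := continuous_symForm.continuousAt.comp (continuousAt_fderiv_fderiv h)
  exact (h1.smul h3).sub (((h2.norm.pow 2).div_const 2).smul continuousAt_const)

lemma schouten_congr {ξ ζ : EuclideanSpace ℝ (Fin n) → ℝ} {x : EuclideanSpace ℝ (Fin n)}
    (h : ξ =ᶠ[𝓝 x] ζ) : schouten ξ x = schouten ζ x := by
  have h1 : fderiv ℝ ξ =ᶠ[𝓝 x] fderiv ℝ ζ := h.fderiv
  rw [schouten, schouten, h.eq_of_nhds, h1.eq_of_nhds, h1.fderiv_eq]

/-- Necessary second order condition for a minimum along the half-line from `y` in the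
direction `a`. -/
lemma second_fderiv_nonneg {w : EuclideanSpace ℝ (Fin n) → ℝ} {y a : EuclideanSpace ℝ (Fin n)}
    (hw : ContDiffAt ℝ 2 w y) (h0 : fderiv ℝ w y a = 0)
    (hmin : ∀ᶠ t : ℝ in 𝓝[>] 0, w y ≤ w (y + t • a)) : 0 ≤ fderiv ℝ (fderiv ℝ w) y a a := by
  by_contra! hneg
  have hline : ∀ t : ℝ, HasDerivAt (fun s : ℝ => y + s • a) a t := fun t => by
    simpa only [id, one_smul] using ((hasDerivAt_id t).smul_const a).const_add y
  have hlt : Tendsto (fun s : ℝ => y + s • a) (𝓝 0) (𝓝 y) := by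
    simpa using (hline 0).continuousAt.tendsto
  have hdiff : ∀ᶠ t : ℝ in 𝓝 0, HasDerivAt (fun s : ℝ => w (y + s • a))
      (fderiv ℝ w (y + t • a) a) t := by
    have : ∀ᶠ x in 𝓝 y, ContDiffAt ℝ 2 w x := hw.eventually (by simp)
    filter_upwards [hlt.eventually this] with t ht
    exact (ht.differentiableAt (by norm_num)).hasFDerivAt.comp_hasDerivAt t (hline t)
  have hder : HasDerivAt (fun s : ℝ => fderiv ℝ w (y + s • a) a)
      (fderiv ℝ (fderiv ℝ w) y a a) 0 := by
    have h1 : HasFDerivAt (fderiv ℝ w) (fderiv ℝ (fderiv ℝ w) y) (y + (0 : ℝ) • a) := by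
      simpa using hasFDerivAt_fderiv hw
    have h2 := h1.comp_hasDerivAt 0 (hline 0)
    exact h2.clm_apply (hasDerivAt_const 0 a) |>.congr_deriv (by simp)
  have hev : ∀ᶠ t : ℝ in 𝓝[>] 0, fderiv ℝ w (y + t • a) a < 0 := by
    have hs := hder.tendsto_slope.mono_left (nhdsGT_le_nhdsNE (0 : ℝ))
    filter_upwards [hs.eventually (gt_mem_nhds hneg), self_mem_nhdsWithin] with s hs hs0
    have hs0 : 0 < s := hs0
    rw [slope_def_field] at hs
    simp only [zero_smul, add_zero, sub_zero, h0] at hs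
    rcases div_neg_iff.mp hs with h | h <;> linarith [h.1, h.2]
  obtain ⟨δ, hδ, hI⟩ := Metric.eventually_nhds_iff.mp hdiff
  obtain ⟨δ', hδ', hI'⟩ := mem_nhdsGT_iff_exists_Ioc_subset.mp hev
  have hδ'0 : (0 : ℝ) < δ' := hδ'
  have hsmall : ∀ᶠ t : ℝ in 𝓝[>] 0, t < min δ δ' :=
    (gt_mem_nhds (lt_min hδ hδ'0)).filter_mono nhdsWithin_le_nhds
  obtain ⟨t, ht1, ht2, ht3⟩ := (hmin.and (hsmall.and self_mem_nhdsWithin)).exists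
  have ht3 : 0 < t := ht3
  have hin : ∀ s ∈ Icc 0 t, HasDerivAt (fun s : ℝ => w (y + s • a))
      (fderiv ℝ w (y + s • a) a) s := fun s hs => hI (by
    rw [Real.dist_eq, sub_zero, abs_of_nonneg hs.1]
    exact lt_of_le_of_lt hs.2 (ht2.trans_le (min_le_left _ _)))
  have hanti : StrictAntiOn (fun s : ℝ => w (y + s • a)) (Icc 0 t) := by
    refine strictAntiOn_of_deriv_neg (convex_Icc 0 t)
      (fun s hs => (hin s hs).continuousAt.continuousWithinAt) fun s hs => ?_
    rw [(hin s (interior_subset hs)).deriv]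
    rw [interior_Icc] at hs
    exact hI' ⟨hs.1, hs.2.le.trans (ht2.trans_le (min_le_right _ _)).le⟩
  have := hanti (by simp [ht3.le] : (0 : ℝ) ∈ Icc 0 t) (by simp [ht3.le]) ht3
  simp only [zero_smul, add_zero] at this
  linarith

/-! ### The Kelvin transform -/

/-- The Kelvin transform of `ξ = u ^ (-2 / (n - 2))` in the sphere of radius `l` about the origin.
It corresponds to `y ↦ (l / |y|) ^ (n - 2) u (l² y / |y|²)`. The value at the origin is `0`. -/
def kelvin (l : ℝ) (ξ : EuclideanSpace ℝ (Fin n) → ℝ) (y : EuclideanSpace ℝ (Fin n)) : ℝ :=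
  ‖y‖ ^ 2 / l ^ 2 * ξ ((l ^ 2 / ‖y‖ ^ 2) • y)

/-- The reflection in the hyperplane orthogonal to `y`. -/
def reflect (y a : EuclideanSpace ℝ (Fin n)) : EuclideanSpace ℝ (Fin n) :=
  a - (2 * inner ℝ y a / ‖y‖ ^ 2) • y

lemma reflect_reflect {y : EuclideanSpace ℝ (Fin n)} (hy : y ≠ 0)
    (a : EuclideanSpace ℝ (Fin n)) : reflect y (reflect y a) = a := by
  have h : ‖y‖ ^ 2 ≠ 0 := by simpa using hy
  simp only [reflect, inner_sub_right, inner_smul_right, real_inner_self_eq_norm_sq]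
  rw [sub_sub, ← add_smul]
  convert sub_zero a
  convert zero_smul ℝ y
  field_simp
  ring

lemma norm_reflect {y : EuclideanSpace ℝ (Fin n)} (hy : y ≠ 0)
    (a : EuclideanSpace ℝ (Fin n)) : ‖reflect y a‖ = ‖a‖ := by
  have h : ‖y‖ ^ 2 ≠ 0 := by simpa using hy
  have : ‖reflect y a‖ ^ 2 = ‖a‖ ^ 2 := by
    rw [reflect, norm_sub_sq_real, inner_smul_right, norm_smul, mul_pow, Real.norm_eq_abs, sq_abs,
      real_inner_comm]
    field_simp
    ring
  exact (sq_eq_sq₀ (norm_nonneg _) (norm_nonneg _)).mp this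

/-- The matrix of `reflect y`. -/
def reflectMat (y : EuclideanSpace ℝ (Fin n)) : Matrix (Fin n) (Fin n) ℝ :=
  1 - (2 / ‖y‖ ^ 2) • Matrix.vecMulVec y y

lemma reflectMat_mulVec (y a : EuclideanSpace ℝ (Fin n)) :
    WithLp.toLp 2 (reflectMat y *ᵥ (⇑a)) = reflect y a := by
  ext i
  have : inner ℝ y a = (⇑y) ⬝ᵥ (⇑a) := by
    simp [PiLp.inner_apply, dotProduct, mul_comm]
  simp [reflectMat, reflect, Matrix.sub_mulVec, Matrix.smul_mulVec, Matrix.vecMulVec_mulVec, this]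
  ring

lemma reflectMat_mem (y : EuclideanSpace ℝ (Fin n)) (hy : y ≠ 0) :
    reflectMat y ∈ Matrix.orthogonalGroup (Fin n) ℝ := by
  have hT : (reflectMat y)ᵀ = reflectMat y := by
    ext i j
    simp [reflectMat, Matrix.one_apply, Matrix.vecMulVec_apply, mul_comm, eq_comm]
  rw [Matrix.mem_orthogonalGroup_iff', hT]
  refine Matrix.ext_of_mulVec_single fun i => ?_
  have h1 := reflect_reflect hy (EuclideanSpace.single i (1 : ℝ))
  rw [← reflectMat_mulVec, ← reflectMat_mulVec] at h1
  have := congrArg (fun v : EuclideanSpace ℝ (Fin n) => (⇑v)) h1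
  rw [← Matrix.mulVec_mulVec, Matrix.one_mulVec]
  simpa using this

/-- `reflect y` as an element of the orthogonal group. -/
def reflectOrth (y : EuclideanSpace ℝ (Fin n)) (hy : y ≠ 0) : Matrix.orthogonalGroup (Fin n) ℝ :=
  ⟨reflectMat y, reflectMat_mem y hy⟩

lemma quad_orthConj_reflectOrth {y : EuclideanSpace ℝ (Fin n)} (hy : y ≠ 0) (M : SymMat n)
    (a : EuclideanSpace ℝ (Fin n)) :
    quad (orthConj (reflectOrth y hy) M) a = quad M (reflect y a) := by
  rw [quad_orthConj, ← reflectMat_mulVec]; rfl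

lemma norm_inv_smul {y : EuclideanSpace ℝ (Fin n)} {l : ℝ} :
    ‖(l ^ 2 / ‖y‖ ^ 2) • y‖ = l ^ 2 / ‖y‖ := by
  rcases eq_or_ne y 0 with rfl | hy
  · simp
  have h : ‖y‖ ≠ 0 := by simpa using hy
  rw [norm_smul, Real.norm_eq_abs, abs_of_nonneg (by positivity)]
  field_simp

lemma inv_smul_ne_zero {y : EuclideanSpace ℝ (Fin n)} {l : ℝ} (hl : l ≠ 0) (hy : y ≠ 0) :
    (l ^ 2 / ‖y‖ ^ 2) • y ≠ 0 := by
  have h : ‖y‖ ≠ 0 := by simpa using hy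
  exact smul_ne_zero (by positivity) hy

lemma inv_smul_inv_smul {y : EuclideanSpace ℝ (Fin n)} {l : ℝ} (hl : l ≠ 0) (hy : y ≠ 0) :
    (l ^ 2 / ‖(l ^ 2 / ‖y‖ ^ 2) • y‖ ^ 2) • ((l ^ 2 / ‖y‖ ^ 2) • y) = y := by
  have h : ‖y‖ ≠ 0 := by simpa using hy
  rw [norm_inv_smul, smul_smul]
  convert one_smul ℝ y
  field_simp

lemma contDiffAt_inv_smul {y : EuclideanSpace ℝ (Fin n)} {l : ℝ} (hy : y ≠ 0) :
    ContDiffAt ℝ 2 (fun y : EuclideanSpace ℝ (Fin n) => (l ^ 2 / ‖y‖ ^ 2) • y) y := by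
  have h : ‖y‖ ^ 2 ≠ 0 := by simpa using hy
  exact (contDiffAt_const.div ((contDiff_norm_sq ℝ).contDiffAt) h).smul contDiffAt_id

lemma contDiffAt_kelvin {ξ : EuclideanSpace ℝ (Fin n) → ℝ} {y : EuclideanSpace ℝ (Fin n)} {l : ℝ}
    (hy : y ≠ 0) (hξ : ContDiffAt ℝ 2 ξ ((l ^ 2 / ‖y‖ ^ 2) • y)) :
    ContDiffAt ℝ 2 (kelvin l ξ) y :=
  (((contDiff_norm_sq ℝ).contDiffAt).div_const _).mul
    (ContDiffAt.comp y hξ (contDiffAt_inv_smul hy))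

/-- The derivative of an inversion is a multiple of a reflection. -/
lemma exists_hasFDerivAt_inv_smul {y : EuclideanSpace ℝ (Fin n)} (l : ℝ) (hy : y ≠ 0) :
    ∃ T : EuclideanSpace ℝ (Fin n) →L[ℝ] EuclideanSpace ℝ (Fin n),
      HasFDerivAt (fun y : EuclideanSpace ℝ (Fin n) => (l ^ 2 / ‖y‖ ^ 2) • y) T y ∧
      ∀ a, T a = (l ^ 2 / ‖y‖ ^ 2) • reflect y a := by
  have h : ‖y‖ ^ 2 ≠ 0 := by simpa using hy
  have h1 : HasFDerivAt (fun y : EuclideanSpace ℝ (Fin n) => ‖y‖ ^ 2) (2 • innerSL ℝ y) y :=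
    (hasStrictFDerivAt_norm_sq y).hasFDerivAt
  have h2 := (((hasDerivAt_inv h).comp_hasFDerivAt y h1).const_mul (l ^ 2)).smul (hasFDerivAt_id y)
  refine ⟨_, h2.congr_of_eventuallyEq ?_, fun a => ?_⟩
  · filter_upwards with x
    simp [div_eq_mul_inv]
  · simp only [reflect, smul_sub, smul_smul]
    simp
    rw [sub_eq_add_neg, ← neg_smul]
    congr 2
    field_simp
    exact neg_smul _ _

lemma hasFDerivAt_kelvin {ξ : EuclideanSpace ℝ (Fin n) → ℝ} {y : EuclideanSpace ℝ (Fin n)} {l : ℝ}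
    (hl : l ≠ 0) (hy : y ≠ 0) (hξ : DifferentiableAt ℝ ξ ((l ^ 2 / ‖y‖ ^ 2) • y)) :
    HasFDerivAt (kelvin l ξ) (fderiv ℝ ξ ((l ^ 2 / ‖y‖ ^ 2) • y)
      + (2 / l ^ 2 * (ξ ((l ^ 2 / ‖y‖ ^ 2) • y)
        - fderiv ℝ ξ ((l ^ 2 / ‖y‖ ^ 2) • y) ((l ^ 2 / ‖y‖ ^ 2) • y))) • innerSL ℝ y) y := by
  have h : ‖y‖ ^ 2 ≠ 0 := by simpa using hy
  obtain ⟨T, hT, hTa⟩ := exists_hasFDerivAt_inv_smul l hy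
  have h1 : HasFDerivAt (fun y : EuclideanSpace ℝ (Fin n) => ‖y‖ ^ 2) (2 • innerSL ℝ y) y :=
    (hasStrictFDerivAt_norm_sq y).hasFDerivAt
  have h2 := (h1.mul_const (l ^ 2)⁻¹).mul
    (HasFDerivAt.comp (f := fun y : EuclideanSpace ℝ (Fin n) => (l ^ 2 / ‖y‖ ^ 2) • y) y
      hξ.hasFDerivAt hT)
  refine (h2.congr_of_eventuallyEq ?_).congr_fderiv ?_
  · filter_upwards with x
    simp [kelvin, div_eq_mul_inv]
  · ext a
    simp [hTa, reflect, map_sub, map_smul]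
    field_simp
    ring

/-- The second derivative of the Kelvin transform: up to a multiple of the identity it is the
second derivative of `ξ` conjugated by a reflection. -/
lemma fderiv_fderiv_kelvin {ξ : EuclideanSpace ℝ (Fin n) → ℝ} {y : EuclideanSpace ℝ (Fin n)}
    {l : ℝ} (hl : l ≠ 0) (hy : y ≠ 0) (hξ : ContDiffAt ℝ 2 ξ ((l ^ 2 / ‖y‖ ^ 2) • y))
    (a b : EuclideanSpace ℝ (Fin n)) :
    fderiv ℝ (fderiv ℝ (kelvin l ξ)) y a b
      = l ^ 2 / ‖y‖ ^ 2 * fderiv ℝ (fderiv ℝ ξ) ((l ^ 2 / ‖y‖ ^ 2) • y) (reflect y a) (reflect y b)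
        + 2 / l ^ 2 * (ξ ((l ^ 2 / ‖y‖ ^ 2) • y)
          - fderiv ℝ ξ ((l ^ 2 / ‖y‖ ^ 2) • y) ((l ^ 2 / ‖y‖ ^ 2) • y)) * inner ℝ a b := by
  have h : ‖y‖ ^ 2 ≠ 0 := by simpa using hy
  obtain ⟨T, hT, hTa⟩ := exists_hasFDerivAt_inv_smul l hy
  set Z : EuclideanSpace ℝ (Fin n) → EuclideanSpace ℝ (Fin n) :=
    fun y => (l ^ 2 / ‖y‖ ^ 2) • y with hZ
  have hZy : (l ^ 2 / ‖y‖ ^ 2) • y = Z y := rfl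
  rw [hZy] at hξ ⊢
  obtain ⟨I, hI⟩ : ∃ I : EuclideanSpace ℝ (Fin n) →L[ℝ] EuclideanSpace ℝ (Fin n) →L[ℝ] ℝ,
      ∀ c, I c = innerSL ℝ c := ⟨innerSL ℝ, fun _ => rfl⟩
  have hev : fderiv ℝ (kelvin l ξ) =ᶠ[𝓝 y] fun y => fderiv ℝ ξ (Z y)
      + (2 / l ^ 2 * (ξ (Z y) - fderiv ℝ ξ (Z y) (Z y))) • I y := by
    have e1 : ∀ᶠ x in 𝓝 y, ContDiffAt ℝ 2 ξ (Z x) :=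
      hT.continuousAt.eventually (hξ.eventually (by simp))
    filter_upwards [e1, isOpen_ne.mem_nhds hy] with x hx hx0
    rw [hI]
    exact (hasFDerivAt_kelvin hl hx0 (hx.differentiableAt (by norm_num))).fderiv
  rw [hev.fderiv_eq]
  have d1 : HasFDerivAt (fun y => fderiv ℝ ξ (Z y)) ((fderiv ℝ (fderiv ℝ ξ) (Z y)).comp T) y :=
    HasFDerivAt.comp y (hasFDerivAt_fderiv hξ) hT
  have d2 : HasFDerivAt (fun y => ξ (Z y)) ((fderiv ℝ ξ (Z y)).comp T) y :=
    HasFDerivAt.comp y (hξ.differentiableAt (by norm_num)).hasFDerivAt hT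
  have d3 := d1.clm_apply hT
  have d4 := d1.add (((d2.sub d3).const_mul (2 / l ^ 2)).smul I.hasFDerivAt)
  have key : HasFDerivAt (fun y => fderiv ℝ ξ (Z y)
      + (2 / l ^ 2 * (ξ (Z y) - fderiv ℝ ξ (Z y) (Z y))) • I y) _ y := d4
  rw [key.fderiv]
  simp [hTa, hI]
  simp only [hZ, reflect, map_sub, map_smul, _root_.sub_apply, _root_.smul_apply, smul_eq_mul]
  field_simp
  ring

/-- Conformal invariance: the Kelvin transform conjugates the conformal Hessian by a reflection. -/
lemma schouten_kelvin {ξ : EuclideanSpace ℝ (Fin n) → ℝ} {y : EuclideanSpace ℝ (Fin n)} {l : ℝ}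
    (hl : l ≠ 0) (hy : y ≠ 0) (hξ : ContDiffAt ℝ 2 ξ ((l ^ 2 / ‖y‖ ^ 2) • y)) :
    schouten (kelvin l ξ) y
      = orthConj (reflectOrth y hy) (schouten ξ ((l ^ 2 / ‖y‖ ^ 2) • y)) := by
  have h : ‖y‖ ^ 2 ≠ 0 := by simpa using hy
  refine eq_of_quad_eq fun a => ?_
  rw [quad_orthConj_reflectOrth, quad_schouten, quad_schouten, fderiv_fderiv_kelvin hl hy hξ,
    (hasFDerivAt_kelvin hl hy (hξ.differentiableAt (by norm_num))).fderiv, norm_reflect hy,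
    real_inner_self_eq_norm_sq]
  set z := (l ^ 2 / ‖y‖ ^ 2) • y with hz
  set L := fderiv ℝ ξ z with hL
  set c := 2 / l ^ 2 * (ξ z - L z) with hc
  have hn : ‖L + c • innerSL ℝ y‖ ^ 2 = ‖L‖ ^ 2 + 2 * c * L y + c ^ 2 * ‖y‖ ^ 2 := by
    obtain ⟨g, hg⟩ := (InnerProductSpace.toDual ℝ (EuclideanSpace ℝ (Fin n))).surjective L
    have h1 : L + c • innerSL ℝ y
        = InnerProductSpace.toDual ℝ (EuclideanSpace ℝ (Fin n)) (g + c • y) := by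
      rw [← hg]; ext b; simp
    rw [h1, ← hg, LinearIsometryEquiv.norm_map, LinearIsometryEquiv.norm_map, norm_add_sq_real,
      inner_smul_right, norm_smul, mul_pow, Real.norm_eq_abs, sq_abs,
      InnerProductSpace.toDual_apply_apply]
    ring
  have hLz : L z = l ^ 2 / ‖y‖ ^ 2 * L y := by
    rw [hz, map_smul, smul_eq_mul]
  have hk : kelvin l ξ y = ‖y‖ ^ 2 / l ^ 2 * ξ z := rfl
  rw [hn, hk, hc, hLz]
  field_simp
  ring

lemma AdmissibleSet.orthConj_mem (hU : AdmissibleSet U) (O : Matrix.orthogonalGroup (Fin n) ℝ)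
    {M : SymMat n} (hM : M ∈ U) : orthConj O M ∈ U := by
  rw [← hU.conj_image O]; exact mem_image_of_mem _ hM

/-- `ξ` solves the equation at `x`: the matrix `schouten ξ x` lies in `U` and has `F = 1`. -/
def SolvesAt (U : Set (SymMat n)) (F : SymMat n → ℝ) (ξ : EuclideanSpace ℝ (Fin n) → ℝ)
    (x : EuclideanSpace ℝ (Fin n)) : Prop :=
  schouten ξ x ∈ U ∧ F (schouten ξ x) = 1

lemma SolvesAt.kelvin (hU : AdmissibleSet U) (hF : AdmissibleFun U F)
    {ξ : EuclideanSpace ℝ (Fin n) → ℝ} {y : EuclideanSpace ℝ (Fin n)} {l : ℝ}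
    (hl : l ≠ 0) (hy : y ≠ 0) (hξ : ContDiffAt ℝ 2 ξ ((l ^ 2 / ‖y‖ ^ 2) • y))
    (h : SolvesAt U F ξ ((l ^ 2 / ‖y‖ ^ 2) • y)) : SolvesAt U F (kelvin l ξ) y := by
  rw [SolvesAt, schouten_kelvin hl hy hξ]
  exact ⟨hU.orthConj_mem _ h.1, (hF.conj_eq _ _ h.1).trans h.2⟩

lemma kelvin_kelvin {ξ : EuclideanSpace ℝ (Fin n) → ℝ} {y : EuclideanSpace ℝ (Fin n)} {l : ℝ}
    (hl : l ≠ 0) (hy : y ≠ 0) : kelvin l (kelvin l ξ) y = ξ y := by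
  have h : ‖y‖ ≠ 0 := by simpa using hy
  rw [kelvin, kelvin, inv_smul_inv_smul hl hy, norm_inv_smul]
  field_simp

/-! ### The boundary point lemma -/

/-- The barrier `s + K s²`, where `s = R² - |y - z|²` is positive exactly in the ball of radius `R`
about `z`. -/
def barrier (z : EuclideanSpace ℝ (Fin n)) (R K : ℝ) (y : EuclideanSpace ℝ (Fin n)) : ℝ :=
  (R ^ 2 - ‖y - z‖ ^ 2) + K * (R ^ 2 - ‖y - z‖ ^ 2) ^ 2

lemma contDiff_barrier (z : EuclideanSpace ℝ (Fin n)) (R K : ℝ) :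
    ContDiff ℝ 2 (barrier z R K) := by
  have h : ContDiff ℝ 2 fun y : EuclideanSpace ℝ (Fin n) => R ^ 2 - ‖y - z‖ ^ 2 :=
    contDiff_const.sub ((contDiff_id.sub contDiff_const).norm_sq ℝ)
  exact h.add (contDiff_const.mul (h.pow 2))

lemma hasFDerivAt_radius_sub (z : EuclideanSpace ℝ (Fin n)) (R : ℝ)
    (y : EuclideanSpace ℝ (Fin n)) :
    HasFDerivAt (fun y : EuclideanSpace ℝ (Fin n) => R ^ 2 - ‖y - z‖ ^ 2)
      ((-2 : ℝ) • innerSL ℝ (y - z)) y := by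
  have h := (hasStrictFDerivAt_norm_sq (y - z)).hasFDerivAt.comp y
    ((hasFDerivAt_id y).sub_const z)
  refine (h.const_sub (R ^ 2)).congr_fderiv ?_
  ext b
  simp

lemma fderiv_barrier (z : EuclideanSpace ℝ (Fin n)) (R K : ℝ) (y : EuclideanSpace ℝ (Fin n)) :
    fderiv ℝ (barrier z R K) y
      = (-2 * (1 + 2 * K * (R ^ 2 - ‖y - z‖ ^ 2))) • innerSL ℝ (y - z) := by
  have h := hasFDerivAt_radius_sub z R y
  have h2 : HasFDerivAt (barrier z R K) _ y := h.add ((h.pow 2).const_mul K)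
  rw [h2.fderiv]
  ext b
  simp
  ring

lemma fderiv_fderiv_barrier (z : EuclideanSpace ℝ (Fin n)) (R K : ℝ)
    (y a : EuclideanSpace ℝ (Fin n)) :
    fderiv ℝ (fderiv ℝ (barrier z R K)) y a a
      = -2 * (1 + 2 * K * (R ^ 2 - ‖y - z‖ ^ 2)) * ‖a‖ ^ 2 + 8 * K * inner ℝ (y - z) a ^ 2 := by
  obtain ⟨I, hI⟩ : ∃ I : EuclideanSpace ℝ (Fin n) →L[ℝ] EuclideanSpace ℝ (Fin n) →L[ℝ] ℝ,
      ∀ c, I c = innerSL ℝ c := ⟨innerSL ℝ, fun _ => rfl⟩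
  have hfun : fderiv ℝ (barrier z R K)
      = fun y => (-2 * (1 + 2 * K * (R ^ 2 - ‖y - z‖ ^ 2))) • I (y - z) := by
    ext1 y; rw [fderiv_barrier, hI]
  have h := hasFDerivAt_radius_sub z R y
  have h1 := ((h.const_mul (2 * K)).const_add 1).const_mul (-2)
  have h2 : HasFDerivAt (fun y => I (y - z)) I y := by
    exact (I.hasFDerivAt.comp y ((hasFDerivAt_id y).sub_const z)).congr_fderiv (by ext; simp)
  have h3 : HasFDerivAt (fun y => (-2 * (1 + 2 * K * (R ^ 2 - ‖y - z‖ ^ 2))) • I (y - z)) _ y :=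
    h1.smul h2
  rw [hfun, h3.fderiv]
  simp [hI, inner_sub_left]
  ring

/-- The closed ball with centre `2 y₀` and radius `|y₀|` touches the closed ball of radius `|y₀|`
about the origin at `y₀` only. -/
lemma norm_lt_of_mem_closedBall {y₀ y : EuclideanSpace ℝ (Fin n)}
    (h : ‖y - (2 : ℝ) • y₀‖ ≤ ‖y₀‖) (hne : y ≠ y₀) : ‖y₀‖ < ‖y‖ := by
  have h1 : ‖y - (2 : ℝ) • y₀‖ ^ 2 ≤ ‖y₀‖ ^ 2 := by gcongr
  rw [norm_sub_sq_real, inner_smul_right, norm_smul] at h1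
  norm_num at h1
  have h2 : 0 < ‖y - y₀‖ ^ 2 := by
    have : 0 < ‖y - y₀‖ := norm_pos_iff.mpr (sub_ne_zero.mpr hne)
    positivity
  rw [norm_sub_sq_real] at h2
  by_contra! h3
  nlinarith [norm_nonneg y, norm_nonneg y₀]

/-- A function that dominates a multiple of the barrier near `y₀` in its ball cannot have vanishing
derivative at `y₀`. -/
lemma false_of_barrier_le {w : EuclideanSpace ℝ (Fin n) → ℝ} {y₀ : EuclideanSpace ℝ (Fin n)}
    {ρ ε K : ℝ} (hy₀ : y₀ ≠ 0) (hρ : 0 < ρ) (hε : 0 < ε) (hK : 0 ≤ K)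
    (hw : HasFDerivAt w (0 : EuclideanSpace ℝ (Fin n) →L[ℝ] ℝ) y₀) (hw0 : w y₀ = 0)
    (h : ∀ y ∈ Metric.closedBall y₀ ρ ∩ Metric.closedBall ((2 : ℝ) • y₀) ‖y₀‖,
      ε * barrier ((2 : ℝ) • y₀) ‖y₀‖ K y ≤ w y) : False := by
  have hR : 0 < ‖y₀‖ := norm_pos_iff.mpr hy₀
  have hline : HasDerivAt (fun t : ℝ => y₀ + t • y₀) y₀ 0 := by
    simpa only [id, one_smul] using ((hasDerivAt_id (0 : ℝ)).smul_const y₀).const_add y₀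
  have hd : HasDerivAt (fun t : ℝ => w (y₀ + t • y₀)) 0 0 := by
    have hw' : HasFDerivAt w (0 : EuclideanSpace ℝ (Fin n) →L[ℝ] ℝ) (y₀ + (0 : ℝ) • y₀) := by
      simpa using hw
    exact (hw'.comp_hasDerivAt 0 hline).congr_deriv (by simp)
  have hs := hd.tendsto_slope.mono_left (nhdsGT_le_nhdsNE (0 : ℝ))
  have hge : ε * ‖y₀‖ ^ 2 ≤ 0 := by
    refine ge_of_tendsto hs ?_
    have hsmall : ∀ᶠ t : ℝ in 𝓝[>] 0, t < min 1 (ρ / ‖y₀‖) :=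
      (gt_mem_nhds (by positivity)).filter_mono nhdsWithin_le_nhds
    filter_upwards [hsmall, self_mem_nhdsWithin] with t ht ht0
    have ht0 : 0 < t := ht0
    have ht1 : t < 1 := ht.trans_le (min_le_left _ _)
    have ht2 : t * ‖y₀‖ < ρ := (lt_div_iff₀ hR).mp (ht.trans_le (min_le_right _ _))
    have hz : y₀ + t • y₀ - (2 : ℝ) • y₀ = (-(1 - t)) • y₀ := by module
    have hn : ‖y₀ + t • y₀ - (2 : ℝ) • y₀‖ = (1 - t) * ‖y₀‖ := by
      rw [hz, norm_smul, norm_neg, Real.norm_eq_abs, abs_of_pos (by linarith)]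
    have hmem : y₀ + t • y₀ ∈ Metric.closedBall y₀ ρ ∩ Metric.closedBall ((2 : ℝ) • y₀) ‖y₀‖ := by
      constructor
      · rw [mem_closedBall_iff_norm, add_sub_cancel_left, norm_smul, Real.norm_eq_abs,
          abs_of_pos ht0]
        exact ht2.le
      · rw [mem_closedBall_iff_norm, hn]; nlinarith
    have h1 := h _ hmem
    rw [barrier, hn] at h1
    rw [slope_def_field]
    simp only [zero_smul, add_zero, sub_zero, hw0]
    rw [le_div_iff₀ ht0]
    refine le_trans ?_ h1
    have h2 : 0 ≤ K * (‖y₀‖ ^ 2 - ((1 - t) * ‖y₀‖) ^ 2) ^ 2 := by positivity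
    have h3 : t * ‖y₀‖ ^ 2 ≤ ‖y₀‖ ^ 2 - ((1 - t) * ‖y₀‖) ^ 2 := by
      have : 0 ≤ t * (1 - t) * ‖y₀‖ ^ 2 := mul_nonneg (mul_nonneg ht0.le (by linarith)) (sq_nonneg _)
      nlinarith
    calc ε * ‖y₀‖ ^ 2 * t = ε * (t * ‖y₀‖ ^ 2) := by ring
      _ ≤ _ := by gcongr; linarith
  have : 0 < ε * ‖y₀‖ ^ 2 := by positivity
  linarith

/-- At a point where `ζ - ξ - ε * barrier` has a negative interior minimum inside the ball of the
barrier, the conformal Hessian of `ζ` exceeds that of `ξ` by `ε` times a matrix with a large rank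
one part. -/
lemma quad_le_of_min {ξ ζ : EuclideanSpace ℝ (Fin n) → ℝ} {z y : EuclideanSpace ℝ (Fin n)}
    {R K ε c C₁ C₂ : ℝ} (hξ : ContDiffAt ℝ 2 ξ y) (hζ : ContDiffAt ℝ 2 ζ y)
    (hR : 0 ≤ R) (hK : 0 ≤ K) (hε : 0 < ε) (hε1 : ε ≤ 1) (hc : c ≤ ζ y) (hc' : ζ y ≤ 4 * c)
    (hc0 : 0 < c)
    (h1 : ‖fderiv ℝ (fderiv ℝ ξ) y‖ ≤ C₁) (h2 : ‖fderiv ℝ ξ y‖ ≤ C₂)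
    (hs : 0 < R ^ 2 - ‖y - z‖ ^ 2) (hKs : K * (R ^ 2 - ‖y - z‖ ^ 2) ≤ 1)
    (hlt : ξ y < ζ y) (hneg : ζ y - ξ y - ε * barrier z R K y < 0)
    (hmin : IsLocalMin (fun x => ζ x - ξ x - ε * barrier z R K x) y)
    (a : EuclideanSpace ℝ (Fin n)) :
    quad (schouten ξ y + ε • ((8 * K * c) • rankOne (y - z)
      - (24 * c + 2 * R ^ 2 * C₁ + 6 * R * C₂ + 18 * R ^ 2) • idMat)) a ≤ quad (schouten ζ y) a := by
  set s := R ^ 2 - ‖y - z‖ ^ 2 with hsdef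
  have hsR : s ≤ R ^ 2 := by rw [hsdef]; nlinarith [sq_nonneg ‖y - z‖]
  have hyz : ‖y - z‖ ≤ R := by
    have : ‖y - z‖ ^ 2 ≤ R ^ 2 := by linarith
    exact (sq_le_sq₀ (norm_nonneg _) hR).mp this
  have hb : barrier z R K y ≤ 2 * R ^ 2 := by
    have : barrier z R K y = s + (K * s) * s := by rw [barrier]; ring
    rw [this]; nlinarith
  have hφ := (contDiff_barrier z R K).contDiffAt (x := y)
  have dξ := hξ.differentiableAt (by norm_num : (2 : WithTop ℕ∞) ≠ 0)
  have dζ := hζ.differentiableAt (by norm_num : (2 : WithTop ℕ∞) ≠ 0)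
  have dφ := hφ.differentiableAt (by norm_num : (2 : WithTop ℕ∞) ≠ 0)
  have hcd : ContDiffAt ℝ 2 (fun x => ζ x - ξ x - ε * barrier z R K x) y :=
    (hζ.sub hξ).sub (contDiffAt_const.mul hφ)
  have hfd : ∀ᶠ x in 𝓝 y, fderiv ℝ (fun x => ζ x - ξ x - ε * barrier z R K x) x
      = fderiv ℝ ζ x - fderiv ℝ ξ x - ε • fderiv ℝ (barrier z R K) x := by
    filter_upwards [hξ.eventually (by simp), hζ.eventually (by simp)] with x hx1 hx2
    exact (((hx2.differentiableAt (by norm_num)).hasFDerivAt.sub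
      (hx1.differentiableAt (by norm_num)).hasFDerivAt).sub
      ((((contDiff_barrier z R K).contDiffAt (x := x)).differentiableAt
        (by norm_num)).hasFDerivAt.const_mul ε)).fderiv
  have hgrad : fderiv ℝ ζ y = fderiv ℝ ξ y + ε • fderiv ℝ (barrier z R K) y := by
    have h0 := hmin.fderiv_eq_zero
    rw [hfd.self_of_nhds] at h0
    rw [← sub_eq_zero, ← h0]; abel
  have hsecond : 0 ≤ fderiv ℝ (fderiv ℝ ζ) y a a - fderiv ℝ (fderiv ℝ ξ) y a a
      - ε * fderiv ℝ (fderiv ℝ (barrier z R K)) y a a := by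
    have := second_fderiv_nonneg (a := a) hcd (by rw [hmin.fderiv_eq_zero]; simp) ?_
    · have hfd' : fderiv ℝ (fun x => ζ x - ξ x - ε * barrier z R K x) =ᶠ[𝓝 y] fun x =>
          fderiv ℝ ζ x - fderiv ℝ ξ x - ε • fderiv ℝ (barrier z R K) x := hfd
      have h3 := ((hasFDerivAt_fderiv hζ).sub (hasFDerivAt_fderiv hξ)).sub
        ((hasFDerivAt_fderiv hφ).const_smul ε)
      have h4 : HasFDerivAt (fun x =>
          fderiv ℝ ζ x - fderiv ℝ ξ x - ε • fderiv ℝ (barrier z R K) x) _ y := h3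
      rw [hfd'.fderiv_eq, h4.fderiv] at this
      simpa using this
    · have hlim : Tendsto (fun t : ℝ => y + t • a) (𝓝[>] 0) (𝓝 y) := by
        have : ContinuousAt (fun t : ℝ => y + t • a) 0 := by fun_prop
        have h := this.tendsto
        simp only [zero_smul, add_zero] at h
        exact h.mono_left nhdsWithin_le_nhds
      exact hlim.eventually hmin
  have hφn : ‖fderiv ℝ (barrier z R K) y‖ ≤ 6 * R := by
    rw [fderiv_barrier, norm_smul, innerSL_apply_norm, Real.norm_eq_abs, abs_mul, ← hsdef,
      abs_of_nonneg (by nlinarith : 0 ≤ 1 + 2 * K * s)]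
    norm_num
    have : 1 + 2 * K * s ≤ 3 := by linarith
    have : 0 ≤ 1 + 2 * K * s := by nlinarith
    calc 2 * (1 + 2 * K * s) * ‖y - z‖ ≤ 2 * 3 * R := by gcongr
      _ = 6 * R := by ring
  have hnorm : ‖fderiv ℝ ζ y‖ ^ 2 ≤ ‖fderiv ℝ ξ y‖ ^ 2 + ε * (12 * R * C₂ + 36 * R ^ 2) := by
    have h3 : ‖fderiv ℝ ζ y‖ ≤ ‖fderiv ℝ ξ y‖ + ε * (6 * R) := by
      rw [hgrad]
      refine (norm_add_le _ _).trans ?_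
      rw [norm_smul, Real.norm_eq_abs, abs_of_pos hε]
      gcongr
    have h4 : ‖fderiv ℝ ζ y‖ ^ 2 ≤ (‖fderiv ℝ ξ y‖ + ε * (6 * R)) ^ 2 := by gcongr
    have h5 : ‖fderiv ℝ ξ y‖ * (ε * R) ≤ C₂ * (ε * R) := by gcongr
    have h6 : ε * (ε * R ^ 2) ≤ 1 * (ε * R ^ 2) := by gcongr
    linarith
  have hD2 : |fderiv ℝ (fderiv ℝ ξ) y a a| ≤ C₁ * ‖a‖ ^ 2 := by
    have h3 := (fderiv ℝ (fderiv ℝ ξ) y).le_opNorm₂ a a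
    rw [Real.norm_eq_abs] at h3
    have : ‖fderiv ℝ (fderiv ℝ ξ) y‖ * ‖a‖ * ‖a‖ ≤ C₁ * ‖a‖ * ‖a‖ := by gcongr
    linarith
  rw [fderiv_fderiv_barrier, ← hsdef] at hsecond
  rw [quad_add, quad_smul, quad_sub, quad_smul, quad_smul, quad_rankOne, quad_idMat,
    quad_schouten, quad_schouten]
  set A := ‖a‖ ^ 2 with hA
  have hA0 : 0 ≤ A := by positivity
  set p := inner ℝ (y - z) a ^ 2 with hp
  have hp0 : 0 ≤ p := by positivity
  set X := fderiv ℝ (fderiv ℝ ξ) y a a with hX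
  set Z := fderiv ℝ (fderiv ℝ ζ) y a a with hZ
  -- lower bound for the Hessian of the difference
  have k1 : ε * (8 * K * p - 6 * A) ≤ Z - X := by
    have : (1 + 2 * K * s) * A ≤ 3 * A := by gcongr; linarith
    have h7 : ε * (8 * K * p - 6 * A) ≤ ε * (-2 * (1 + 2 * K * s) * A + 8 * K * p) := by
      gcongr; linarith
    linarith
  have k2 : ε * (8 * K * c * p - 24 * c * A) ≤ ζ y * (Z - X) := by
    have hζ0 : 0 ≤ ζ y := by linarith
    have h7 : ζ y * (ε * (8 * K * p - 6 * A)) ≤ ζ y * (Z - X) := by gcongr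
    have h8 : c * (ε * (K * p)) ≤ ζ y * (ε * (K * p)) := by gcongr
    have h9 : ζ y * (ε * A) ≤ 4 * c * (ε * A) := by gcongr
    linarith
  have k3 : -(ε * (2 * R ^ 2 * C₁ * A)) ≤ (ζ y - ξ y) * X := by
    have hC : 0 ≤ C₁ * A := (abs_nonneg _).trans hD2
    have h7 : ζ y - ξ y ≤ ε * (2 * R ^ 2) := by
      have : ε * barrier z R K y ≤ ε * (2 * R ^ 2) := by gcongr
      linarith
    have h8 : (ζ y - ξ y) * (C₁ * A) ≤ ε * (2 * R ^ 2) * (C₁ * A) := by gcongr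
    have h9 : (ζ y - ξ y) * (-(C₁ * A)) ≤ (ζ y - ξ y) * X := by
      have := (abs_le.mp hD2).1
      have h10 : 0 ≤ ζ y - ξ y := by linarith
      gcongr
    linarith
  have k4 : ‖fderiv ℝ ζ y‖ ^ 2 * A ≤ (‖fderiv ℝ ξ y‖ ^ 2 + ε * (12 * R * C₂ + 36 * R ^ 2)) * A := by
    gcongr
  linarith

/-- The boundary point lemma. Two solutions that agree at `y₀` together with their gradients
cannot be strictly ordered on the side `|y| > |y₀|`. At `y₀` itself nothing is asked of the smaller
function beyond smoothness: its conformal Hessian there may lie outside `U`. -/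
lemma false_of_touching (hU : AdmissibleSet U) (hF : AdmissibleFun U F)
    {ξ ζ : EuclideanSpace ℝ (Fin n) → ℝ} {y₀ : EuclideanSpace ℝ (Fin n)} (hy₀ : y₀ ≠ 0)
    (hξ : ContDiffAt ℝ 2 ξ y₀) (hζ : ContDiffAt ℝ 2 ζ y₀) (hpos : 0 < ξ y₀) (heq : ξ y₀ = ζ y₀)
    (hgrad : fderiv ℝ ξ y₀ = fderiv ℝ ζ y₀)
    (hAU : schouten ζ y₀ ∈ U)
    (hsol : ∀ᶠ y in 𝓝[≠] y₀, SolvesAt U F ξ y ∧ SolvesAt U F ζ y)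
    (hlt : ∀ᶠ y in 𝓝 y₀, ‖y₀‖ < ‖y‖ → ξ y < ζ y) : False := by
  set R := ‖y₀‖ with hRdef
  have hR : 0 < R := norm_pos_iff.mpr hy₀
  set z : EuclideanSpace ℝ (Fin n) := (2 : ℝ) • y₀ with hz
  have hy₀z : ‖y₀ - z‖ = R := by
    have : y₀ - z = -y₀ := by rw [hz]; module
    rw [this, norm_neg]
  set c := ξ y₀ / 2 with hc
  have hc0 : 0 < c := by positivity
  set C₁ := ‖fderiv ℝ (fderiv ℝ ξ) y₀‖ + 1 with hC₁
  set C₂ := ‖fderiv ℝ ξ y₀‖ + 1 with hC₂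
  set C := 24 * c + 2 * R ^ 2 * C₁ + 6 * R * C₂ + 18 * R ^ 2 with hC
  have hC0 : 0 ≤ C := by positivity
  set L := fderiv ℝ F (schouten ζ y₀) with hL
  have hLr : 0 < L (rankOne (y₀ - z)) := by
    refine hF.fderiv_pos hAU (fun a => by rw [quad_rankOne]; positivity) fun h0 => ?_
    have h1 := quad_rankOne (y₀ - z) (y₀ - z)
    rw [h0, real_inner_self_eq_norm_sq, hy₀z] at h1
    have : (R ^ 2) ^ 2 = 0 := by rw [← h1]; simp [quad]
    have : 0 < (R ^ 2) ^ 2 := by positivity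
    linarith
  -- `K` is chosen so that the rank one part of the barrier dominates in the direction of `F`.
  set K := (C * |L idMat| + 1) / (8 * c * L (rankOne (y₀ - z))) with hK
  have hK0 : 0 ≤ K := by positivity
  set D : EuclideanSpace ℝ (Fin n) → SymMat n :=
    fun y => (8 * K * c) • rankOne (y - z) - C • idMat with hD
  have hLD : 0 < L (D y₀) := by
    have h1 : L (D y₀) = 8 * K * c * L (rankOne (y₀ - z)) - C * L idMat := by
      simp [hD]
    have h2 : 8 * K * c * L (rankOne (y₀ - z)) = C * |L idMat| + 1 := by
      rw [hK]; field_simp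
    have h3 : C * L idMat ≤ C * |L idMat| := by gcongr; exact le_abs_self _
    linarith
  have hDcont : Continuous D := by
    have : Continuous fun y => rankOne (y - z) :=
      continuous_rankOne.comp (continuous_id.sub continuous_const)
    exact (this.const_smul (8 * K * c)).sub continuous_const
  -- shrinking to a neighbourhood of `y₀` and small `ε`
  have hev : ∀ᶠ p : EuclideanSpace ℝ (Fin n) × ℝ in 𝓝 (y₀, 0),
      schouten ζ p.1 - p.2 • D p.1 ∈ U ∧
        (0 < p.2 → F (schouten ζ p.1 - p.2 • D p.1) < F (schouten ζ p.1)) := by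
    have ht : Tendsto (fun p : EuclideanSpace ℝ (Fin n) × ℝ => (schouten ζ p.1, D p.1, p.2))
        (𝓝 (y₀, 0)) (𝓝 (schouten ζ y₀, D y₀, 0)) := by
      have e1 : ContinuousAt (fun p : EuclideanSpace ℝ (Fin n) × ℝ => schouten ζ p.1) (y₀, 0) :=
        ContinuousAt.comp (f := Prod.fst) (x := (y₀, (0 : ℝ))) (continuousAt_schouten hζ)
          continuousAt_fst
      have e2 : ContinuousAt (fun p : EuclideanSpace ℝ (Fin n) × ℝ => D p.1) (y₀, 0) :=
        (hDcont.comp continuous_fst).continuousAt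
      exact (e1.prodMk (e2.prodMk continuousAt_snd)).tendsto
    exact ht.eventually (hF.eventually_lt hU hAU hLD)
  rw [nhds_prod_eq, eventually_prod_iff] at hev
  obtain ⟨pa, hpa, pb, hpb, hpab⟩ := hev
  have hscont : Continuous fun y : EuclideanSpace ℝ (Fin n) => K * (R ^ 2 - ‖y - z‖ ^ 2) := by
    fun_prop
  have e1 : ∀ᶠ y in 𝓝 y₀, c < ζ y :=
    hζ.continuousAt.eventually (lt_mem_nhds (by rw [← heq]; linarith))
  have e2 : ∀ᶠ y in 𝓝 y₀, ζ y < 4 * c :=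
    hζ.continuousAt.eventually (gt_mem_nhds (by rw [← heq]; linarith))
  have e3 : ∀ᶠ y in 𝓝 y₀, ‖fderiv ℝ (fderiv ℝ ξ) y‖ < C₁ := by
    have hn : Continuous fun B : EuclideanSpace ℝ (Fin n) →L[ℝ]
        EuclideanSpace ℝ (Fin n) →L[ℝ] ℝ => ‖B‖ :=
      @continuous_norm (EuclideanSpace ℝ (Fin n) →L[ℝ] EuclideanSpace ℝ (Fin n) →L[ℝ] ℝ) _
    exact (ContinuousAt.comp hn.continuousAt (continuousAt_fderiv_fderiv hξ)).eventually
      (gt_mem_nhds (lt_add_one _))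
  have e4 : ∀ᶠ y in 𝓝 y₀, ‖fderiv ℝ ξ y‖ < C₂ := by
    have := (contDiffAt_fderiv hξ).continuousAt.norm
    exact this.eventually (gt_mem_nhds (lt_add_one _))
  have e5 : ∀ᶠ y in 𝓝 y₀, K * (R ^ 2 - ‖y - z‖ ^ 2) < 1 :=
    hscont.continuousAt.eventually (gt_mem_nhds (by simp [hy₀z]))
  have e6 : ∀ᶠ y in 𝓝 y₀, y ≠ y₀ → SolvesAt U F ξ y ∧ SolvesAt U F ζ y :=
    eventually_nhdsWithin_iff.mp hsol
  have e7 : ∀ᶠ y in 𝓝 y₀, ContDiffAt ℝ 2 ξ y := hξ.eventually (by simp)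
  have e8 : ∀ᶠ y in 𝓝 y₀, ContDiffAt ℝ 2 ζ y := hζ.eventually (by simp)
  obtain ⟨ρ, hρ, hball⟩ := Metric.nhds_basis_closedBall.eventually_iff.mp
    (e1.and (e2.and (e3.and (e4.and (e5.and (e6.and (e7.and (e8.and (hlt.and hpa)))))))))
  have hcw : ContinuousOn (fun y => ζ y - ξ y) (Metric.closedBall y₀ ρ) := fun y hy => by
    obtain ⟨-, -, -, -, -, -, h7, h8, -⟩ := hball hy
    exact (h8.continuousAt.sub h7.continuousAt).continuousWithinAt
  -- positive lower bound for `ζ - ξ` on the part of the sphere about `y₀` inside the ball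
  obtain ⟨m, hm0, hm⟩ : ∃ m : ℝ, 0 < m ∧
      ∀ y ∈ Metric.sphere y₀ ρ ∩ Metric.closedBall z R, m ≤ ζ y - ξ y := by
    have hcomp : IsCompact (Metric.sphere y₀ ρ ∩ Metric.closedBall z R) :=
      (isCompact_sphere y₀ ρ).inter_right Metric.isClosed_closedBall
    rcases (Metric.sphere y₀ ρ ∩ Metric.closedBall z R).eq_empty_or_nonempty with h0 | hne
    · exact ⟨1, one_pos, by simp [h0]⟩
    · obtain ⟨x, hx, hxm⟩ := hcomp.exists_isMinOn hne
        (hcw.mono (inter_subset_left.trans Metric.sphere_subset_closedBall))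
      refine ⟨ζ x - ξ x, ?_, fun y hy => hxm hy⟩
      have hxne : x ≠ y₀ := by
        rintro rfl
        have := hx.1
        simp at this
        linarith
      have h1 := norm_lt_of_mem_closedBall (mem_closedBall_iff_norm.mp hx.2) hxne
      obtain ⟨-, -, -, -, -, -, -, -, h9, -⟩ := hball (Metric.sphere_subset_closedBall hx.1)
      linarith [h9 h1]
  obtain ⟨ε, hε0, hε1, hεm, hεb⟩ : ∃ ε : ℝ, 0 < ε ∧ ε ≤ 1 ∧ ε * (2 * R ^ 2) < m ∧ pb ε := by
    have f1 : ∀ᶠ ε : ℝ in 𝓝 0, ε < 1 := gt_mem_nhds one_pos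
    have f2 : ∀ᶠ ε : ℝ in 𝓝 0, ε * (2 * R ^ 2) < m := by
      have : Continuous fun ε : ℝ => ε * (2 * R ^ 2) := by fun_prop
      exact this.continuousAt.eventually (gt_mem_nhds (by simpa using hm0))
    obtain ⟨ε, ⟨h1, h2, h3⟩, h4⟩ :=
      (((f1.and (f2.and hpb)).filter_mono (nhdsWithin_le_nhds (s := Ioi 0))).and
        self_mem_nhdsWithin).exists
    exact ⟨ε, h4, h1.le, h2, h3⟩
  have hNcomp : IsCompact (Metric.closedBall y₀ ρ ∩ Metric.closedBall z R) :=
    (isCompact_closedBall y₀ ρ).inter_right Metric.isClosed_closedBall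
  have hy₀N : y₀ ∈ Metric.closedBall y₀ ρ ∩ Metric.closedBall z R :=
    ⟨Metric.mem_closedBall_self hρ.le, by rw [mem_closedBall_iff_norm, hy₀z]⟩
  obtain ⟨y, hyN, hymin⟩ := hNcomp.exists_isMinOn ⟨y₀, hy₀N⟩
    (f := fun y => ζ y - ξ y - ε * barrier z R K y)
    ((hcw.mono inter_subset_left).sub
      (continuous_const.mul (contDiff_barrier z R K).continuous).continuousOn)
  obtain ⟨h1, h2, h3, h4, h5, h6, h7, h8, h9, h10⟩ := hball hyN.1
  rcases le_or_gt 0 (ζ y - ξ y - ε * barrier z R K y) with hnn | hneg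
  · refine false_of_barrier_le (w := fun y => ζ y - ξ y) hy₀ hρ hε0 hK0 ?_ (by simp [heq])
      fun x hx => ?_
    · have := (hζ.differentiableAt (by norm_num)).hasFDerivAt.sub
        (hξ.differentiableAt (by norm_num)).hasFDerivAt
      rwa [hgrad, sub_self] at this
    · have h11 : ζ y - ξ y - ε * barrier z R K y ≤ ζ x - ξ x - ε * barrier z R K x := hymin hx
      linarith
  · have hyz : ‖y - z‖ ≤ R := mem_closedBall_iff_norm.mp hyN.2
    have hs0 : 0 ≤ R ^ 2 - ‖y - z‖ ^ 2 := by
      have : ‖y - z‖ ^ 2 ≤ R ^ 2 := by gcongr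
      linarith
    have hbar : barrier z R K y
        = (1 + K * (R ^ 2 - ‖y - z‖ ^ 2)) * (R ^ 2 - ‖y - z‖ ^ 2) := by rw [barrier]; ring
    have hw0 : 0 ≤ ζ y - ξ y := by
      rcases eq_or_ne y y₀ with rfl | hne
      · rw [heq, sub_self]
      · linarith [h9 (norm_lt_of_mem_closedBall hyz hne)]
    have hs : 0 < R ^ 2 - ‖y - z‖ ^ 2 := by
      rcases hs0.lt_or_eq with h | h
      · exact h
      · rw [hbar, ← h] at hneg; linarith
    have hyz' : ‖y - z‖ < R := by
      have : ‖y - z‖ ^ 2 < R ^ 2 := by linarith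
      exact (sq_lt_sq₀ (norm_nonneg _) hR.le).mp this
    have hne : y ≠ y₀ := by rintro rfl; linarith
    have hyρ : dist y y₀ < ρ := by
      refine lt_of_le_of_ne hyN.1 fun h => ?_
      have h11 := hm y ⟨h, hyN.2⟩
      have h12 : barrier z R K y ≤ 2 * R ^ 2 := by
        rw [hbar]; nlinarith [sq_nonneg ‖y - z‖]
      have h13 : ε * barrier z R K y ≤ ε * (2 * R ^ 2) := by gcongr
      linarith
    have hloc : IsLocalMin (fun x => ζ x - ξ x - ε * barrier z R K x) y := by
      refine hymin.isLocalMin (inter_mem (mem_of_superset (Metric.isOpen_ball.mem_nhds hyρ)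
        Metric.ball_subset_closedBall) ?_)
      exact mem_of_superset (Metric.isOpen_ball.mem_nhds (mem_ball_iff_norm.mpr hyz'))
        Metric.ball_subset_closedBall
    have hq := quad_le_of_min h7 h8 hR.le hK0 hε0 hε1 h1.le h2.le hc0 h3.le h4.le hs h5.le
      (h9 (norm_lt_of_mem_closedBall hyz hne)) hneg hloc
    have hp := hpab h10 hεb
    have hlt := hp.2 hε0
    have hmono := hF.mono hU (h6 hne).1.1 hp.1 fun a => ?_
    · rw [(h6 hne).1.2] at hmono
      simp only [(h6 hne).2.2] at hlt
      linarith
    · have := hq a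
      simp only [quad_add, quad_sub, quad_smul, hD] at this ⊢
      linarith

/-! ### The method of moving spheres -/

lemma kelvin_eq_self {ξ : EuclideanSpace ℝ (Fin n) → ℝ} {y : EuclideanSpace ℝ (Fin n)}
    (hy : y ≠ 0) : kelvin ‖y‖ ξ y = ξ y := by
  have h : ‖y‖ ≠ 0 := by simpa using hy
  simp [kelvin, h]

lemma continuousAt_kelvin_uncurry {ξ : EuclideanSpace ℝ (Fin n) → ℝ}
    {y : EuclideanSpace ℝ (Fin n)} {l : ℝ} (hl : l ≠ 0) (hy : y ≠ 0)
    (hξ : ContinuousAt ξ ((l ^ 2 / ‖y‖ ^ 2) • y)) :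
    ContinuousAt (fun q : ℝ × EuclideanSpace ℝ (Fin n) => kelvin q.1 ξ q.2) (l, y) := by
  have h : ‖y‖ ^ 2 ≠ 0 := by simpa using hy
  have h1 : ContinuousAt (fun q : ℝ × EuclideanSpace ℝ (Fin n) => ‖q.2‖ ^ 2 / q.1 ^ 2) (l, y) :=
    ContinuousAt.div (by fun_prop) (by fun_prop) (pow_ne_zero 2 hl)
  have h2 : ContinuousAt (fun q : ℝ × EuclideanSpace ℝ (Fin n) => (q.1 ^ 2 / ‖q.2‖ ^ 2) • q.2)
      (l, y) := by
    have h3 : ContinuousAt (fun q : ℝ × EuclideanSpace ℝ (Fin n) => q.1 ^ 2 / ‖q.2‖ ^ 2) (l, y) :=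
      ContinuousAt.div (by fun_prop) (by fun_prop) h
    exact h3.smul continuousAt_snd
  exact h1.mul (ContinuousAt.comp (g := ξ) (x := (l, y)) hξ h2)

/-- If the reflection inequality in the sphere of radius `l` fails at `y`, then `ξ (t y) / t` is
somewhere increasing between `y` and its mirror image. -/
lemma exists_lt_fderiv_of_kelvin_lt {ξ : EuclideanSpace ℝ (Fin n) → ℝ}
    {y : EuclideanSpace ℝ (Fin n)} {l : ℝ} (hC : ∀ y ≠ 0, ContDiffAt ℝ 2 ξ y) (hl : 0 < l)
    (hly : l ≤ ‖y‖) (h : kelvin l ξ y < ξ y) :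
    ∃ t ∈ Ioo (l ^ 2 / ‖y‖ ^ 2) 1, ξ (t • y) < fderiv ℝ ξ (t • y) (t • y) := by
  have hy0 : 0 < ‖y‖ := hl.trans_le hly
  have hy : y ≠ 0 := norm_pos_iff.mp hy0
  have hly' : l < ‖y‖ := by
    refine lt_of_le_of_ne hly ?_
    rintro rfl
    rw [kelvin_eq_self hy] at h
    exact lt_irrefl _ h
  set τ := l ^ 2 / ‖y‖ ^ 2 with hτ
  have hτ0 : 0 < τ := by positivity
  have hτ1 : τ < 1 := by
    rw [hτ, div_lt_one (by positivity)]; gcongr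
  have hd : ∀ t : ℝ, 0 < t → HasDerivAt (fun s : ℝ => ξ (s • y) / s)
      ((fderiv ℝ ξ (t • y) y * t - ξ (t • y) * 1) / t ^ 2) t := fun t ht => by
    have h1 : HasDerivAt (fun s : ℝ => s • y) y t := by
      simpa only [id, one_smul] using (hasDerivAt_id t).smul_const y
    have h2 : HasFDerivAt ξ (fderiv ℝ ξ (t • y)) (t • y) :=
      ((hC _ (smul_ne_zero ht.ne' hy)).differentiableAt (by norm_num)).hasFDerivAt
    exact (h2.comp_hasDerivAt t h1).div (hasDerivAt_id t) ht.ne'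
  obtain ⟨t, ht, hts⟩ := exists_hasDerivAt_eq_slope (fun s : ℝ => ξ (s • y) / s) _ hτ1
    (fun t ht => (hd t (hτ0.trans_le ht.1)).continuousAt.continuousWithinAt)
    (fun t ht => hd t (hτ0.trans ht.1))
  refine ⟨t, ht, ?_⟩
  have ht0 : 0 < t := hτ0.trans ht.1
  have h1 : ξ (τ • y) / τ = kelvin l ξ y := by
    rw [kelvin, ← hτ]
    rw [div_eq_mul_inv, mul_comm, hτ, inv_div]
  simp only [one_smul, div_one, h1] at hts
  have h2 : 0 < (ξ y - kelvin l ξ y) / (1 - τ) := div_pos (by linarith) (by linarith)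
  rw [← hts, div_pos_iff_of_pos_right (by positivity)] at h2
  rw [map_smul, smul_eq_mul]
  linarith

lemma exists_lt_of_tendsto_zero {ξ : EuclideanSpace ℝ (Fin n) → ℝ} {β c : ℝ}
    (h0 : Tendsto ξ (𝓝[≠] 0) (𝓝 β)) (hc : c < β) :
    ∃ δ > 0, ∀ y, y ≠ 0 → ‖y‖ < δ → c < ξ y := by
  have := eventually_nhdsWithin_iff.mp (h0.eventually (lt_mem_nhds hc))
  obtain ⟨δ, hδ, h⟩ := Metric.eventually_nhds_iff.mp this
  exact ⟨δ, hδ, fun y hy hyd => h (by simpa using hyd) hy⟩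

lemma exists_lt_of_tendsto_infinity {ξ : EuclideanSpace ℝ (Fin n) → ℝ} {α c : ℝ}
    (hinf : Tendsto (kelvin 1 ξ) (𝓝[≠] 0) (𝓝 α)) (hc : α < c) :
    ∃ M > 0, ∀ y, M < ‖y‖ → ξ y < c * ‖y‖ ^ 2 := by
  have := eventually_nhdsWithin_iff.mp (hinf.eventually (gt_mem_nhds hc))
  obtain ⟨δ, hδ, h⟩ := Metric.eventually_nhds_iff.mp this
  refine ⟨1 / δ, by positivity, fun y hy => ?_⟩
  have hy0 : 0 < ‖y‖ := lt_trans (by positivity) hy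
  have hyne : y ≠ 0 := norm_pos_iff.mp hy0
  have h1 := h (y := ((1 : ℝ) ^ 2 / ‖y‖ ^ 2) • y) (by
    rw [dist_zero_right, norm_inv_smul, one_pow, div_lt_iff₀ hy0]
    rwa [div_lt_iff₀ hδ, mul_comm] at hy) (inv_smul_ne_zero one_ne_zero hyne)
  rw [← kelvin_kelvin (ξ := ξ) one_ne_zero hyne, kelvin]
  rw [one_pow, div_one, mul_comm] at *
  gcongr

/-- At infinity the reflection inequality is strict, uniformly for all radii up to some radius
larger than `l`, as long as `l² α < β`. -/
lemma exists_lt_kelvin_of_norm_gt {ξ : EuclideanSpace ℝ (Fin n) → ℝ} {α β l : ℝ}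
    (hα : 0 < α) (h0 : Tendsto ξ (𝓝[≠] 0) (𝓝 β)) (hinf : Tendsto (kelvin 1 ξ) (𝓝[≠] 0) (𝓝 α))
    (hlt : l ^ 2 * α < β) :
    ∃ l' > l, ∃ M > 0, ∀ μ, 0 < μ → μ ≤ l' → ∀ y, M < ‖y‖ → ξ y < kelvin μ ξ y := by
  obtain ⟨c₂, hc1, hc2⟩ := exists_between hlt
  have hev : ∀ᶠ t : ℝ in 𝓝 0, (l + t) ^ 2 * (α + t) < c₂ := by
    have : Continuous fun t : ℝ => (l + t) ^ 2 * (α + t) := by fun_prop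
    exact this.continuousAt.eventually (gt_mem_nhds (by simpa using hc1))
  obtain ⟨t, ht, ht0⟩ := ((hev.filter_mono (nhdsWithin_le_nhds (s := Ioi 0))).and
    self_mem_nhdsWithin).exists
  have ht0 : 0 < t := ht0
  obtain ⟨δ, hδ, hδ'⟩ := exists_lt_of_tendsto_zero h0 hc2
  obtain ⟨M, hM, hM'⟩ := exists_lt_of_tendsto_infinity hinf (by linarith : α < α + t)
  refine ⟨l + t, by linarith, max M ((l + t) ^ 2 / δ), lt_max_of_lt_left hM,
    fun μ hμ hμl y hy => ?_⟩
  have h1 := hM' y ((le_max_left _ _).trans_lt hy)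
  have hy0 : 0 < ‖y‖ := hM.trans ((le_max_left _ _).trans_lt hy)
  have h2 : (l + t) ^ 2 < ‖y‖ * δ := (div_lt_iff₀ hδ).mp ((le_max_right _ _).trans_lt hy)
  have hμ2 : μ ^ 2 ≤ (l + t) ^ 2 := by gcongr
  have h3 := hδ' ((μ ^ 2 / ‖y‖ ^ 2) • y) (inv_smul_ne_zero hμ.ne' (norm_pos_iff.mp hy0)) (by
    rw [norm_inv_smul, div_lt_iff₀ hy0]; linarith)
  refine h1.trans_le ?_
  rw [kelvin, div_mul_eq_mul_div, le_div_iff₀ (by positivity)]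
  have h4 : μ ^ 2 * (α + t) ≤ (l + t) ^ 2 * (α + t) := by gcongr
  calc (α + t) * ‖y‖ ^ 2 * μ ^ 2 = ‖y‖ ^ 2 * (μ ^ 2 * (α + t)) := by ring
    _ ≤ _ := by gcongr; linarith

/-- Small spheres satisfy the reflection inequality, because `ξ (t y) / t` is decreasing near the
origin. -/
lemma exists_forall_le_kelvin {ξ : EuclideanSpace ℝ (Fin n) → ℝ} {α β Λ : ℝ} (hΛ : 0 < Λ)
    (hC : ∀ y ≠ 0, ContDiffAt ℝ 2 ξ y) (hα : 0 < α) (hβ : 0 < β)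
    (h0 : Tendsto ξ (𝓝[≠] 0) (𝓝 β))
    (hg : Tendsto (fun y => ‖y‖ * ‖fderiv ℝ ξ y‖) (𝓝[≠] 0) (𝓝 0))
    (hinf : Tendsto (kelvin 1 ξ) (𝓝[≠] 0) (𝓝 α)) (hle : Λ ^ 2 * α ≤ β) :
    ∃ l, 0 < l ∧ l ≤ Λ ∧ ∀ y, l ≤ ‖y‖ → ξ y ≤ kelvin l ξ y := by
  obtain ⟨l', hl', M, hM, hMlt⟩ := exists_lt_kelvin_of_norm_gt (l := Λ / 2) hα h0 hinf
    (by nlinarith [mul_pos (pow_pos hΛ 2) hα])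
  have hl'0 : 0 < l' := lt_trans (by positivity) hl'
  obtain ⟨δ, hδ, hδ'⟩ := exists_lt_of_tendsto_zero h0 (half_lt_self hβ)
  obtain ⟨r, hr, hr'⟩ : ∃ r > 0, ∀ y, y ≠ 0 → ‖y‖ < r → ‖y‖ * ‖fderiv ℝ ξ y‖ < β / 2 := by
    have := eventually_nhdsWithin_iff.mp (hg.eventually (gt_mem_nhds (half_pos hβ)))
    obtain ⟨δ, hδ, h⟩ := Metric.eventually_nhds_iff.mp this
    exact ⟨δ, hδ, fun y hy hyd => h (by simpa using hyd) hy⟩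
  set r₀ := min δ r with hr₀
  have hr₀0 : 0 < r₀ := lt_min hδ hr
  have hK : IsCompact (Metric.closedBall (0 : EuclideanSpace ℝ (Fin n)) M ∩ {y | r₀ ≤ ‖y‖}) :=
    (isCompact_closedBall _ _).inter_right (isClosed_le continuous_const continuous_norm)
  obtain ⟨B, hB⟩ := hK.bddAbove_image (f := ξ) fun y hy =>
    (hC y (norm_pos_iff.mp (hr₀0.trans_le hy.2))).continuousAt.continuousWithinAt
  have hev : ∀ᶠ l : ℝ in 𝓝 0, l < Λ ∧ l < l' ∧ l ^ 2 < δ * r₀ ∧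
      l ^ 2 * B < r₀ ^ 2 * (β / 2) := by
    have c1 : Continuous fun l : ℝ => l ^ 2 := by fun_prop
    have c2 : Continuous fun l : ℝ => l ^ 2 * B := by fun_prop
    have p1 : (0 : ℝ) ^ 2 < δ * r₀ := by rw [zero_pow two_ne_zero]; positivity
    have p2 : (0 : ℝ) ^ 2 * B < r₀ ^ 2 * (β / 2) := by
      rw [zero_pow two_ne_zero, zero_mul]; positivity
    exact (gt_mem_nhds hΛ).and ((gt_mem_nhds hl'0).and
      ((c1.continuousAt.eventually (gt_mem_nhds p1)).and
        (c2.continuousAt.eventually (gt_mem_nhds p2))))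
  obtain ⟨l, ⟨hlΛ, hll', hlδ, hlB⟩, hl0⟩ :=
    ((hev.filter_mono (nhdsWithin_le_nhds (s := Ioi 0))).and self_mem_nhdsWithin).exists
  have hl0 : 0 < l := hl0
  refine ⟨l, hl0, hlΛ.le, fun y hly => ?_⟩
  have hy0 : 0 < ‖y‖ := hl0.trans_le hly
  have hyne : y ≠ 0 := norm_pos_iff.mp hy0
  rcases lt_or_ge ‖y‖ r₀ with h1 | h1
  · by_contra! hcon
    obtain ⟨t, ht, hlt⟩ := exists_lt_fderiv_of_kelvin_lt hC hl0 hly hcon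
    have ht0 : 0 < t := lt_trans (by positivity) ht.1
    have hn : ‖t • y‖ < r₀ := by
      rw [norm_smul, Real.norm_eq_abs, abs_of_pos ht0]
      nlinarith [ht.2]
    have hne := smul_ne_zero ht0.ne' hyne
    have h2 := hδ' _ hne (hn.trans_le (min_le_left _ _))
    have h3 := hr' _ hne (hn.trans_le (min_le_right _ _))
    have h4 := (le_abs_self _).trans ((fderiv ℝ ξ (t • y)).le_opNorm (t • y))
    linarith
  · rcases lt_or_ge M ‖y‖ with h2 | h2
    · exact (hMlt l hl0 hll'.le y h2).le
    · have h3 : ξ y ≤ B := hB ⟨y, ⟨by simpa using h2, h1⟩, rfl⟩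
      have h4 := hδ' ((l ^ 2 / ‖y‖ ^ 2) • y) (inv_smul_ne_zero hl0.ne' hyne) (by
        rw [norm_inv_smul, div_lt_iff₀ hy0]
        have : δ * r₀ ≤ δ * ‖y‖ := by gcongr
        linarith)
      rw [kelvin, div_mul_eq_mul_div, le_div_iff₀ (by positivity)]
      have h5 : r₀ ^ 2 * (β / 2) ≤ ‖y‖ ^ 2 * ξ ((l ^ 2 / ‖y‖ ^ 2) • y) := by gcongr
      have h6 : ξ y * l ^ 2 ≤ B * l ^ 2 := by gcongr
      linarith

section Continuation

variable {ξ : EuclideanSpace ℝ (Fin n) → ℝ} {p : EuclideanSpace ℝ (Fin n)} {l : ℝ}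

/-- The boundary point lemma applied to `ξ` and its Kelvin transform. -/
lemma false_of_touching_kelvin (hU : AdmissibleSet U) (hF : AdmissibleFun U F)
    (hC : ∀ y ≠ 0, ContDiffAt ℝ 2 ξ y) (hpos : ∀ y ≠ 0, 0 < ξ y)
    (hsol : ∀ y ≠ 0, y ≠ p → SolvesAt U F ξ y) (hp : p = 0 ∨ l < ‖p‖) (hl : 0 < l)
    {y₀ : EuclideanSpace ℝ (Fin n)} (hly : l ≤ ‖y₀‖) (heq : ξ y₀ = kelvin l ξ y₀)
    (hgrad : fderiv ℝ ξ y₀ = fderiv ℝ (kelvin l ξ) y₀)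
    (hlt : ∀ y, ‖y₀‖ < ‖y‖ → ξ y < kelvin l ξ y) : False := by
  have hy0 : 0 < ‖y₀‖ := hl.trans_le hly
  have hyne : y₀ ≠ 0 := norm_pos_iff.mp hy0
  have hz := inv_smul_ne_zero hl.ne' hyne
  -- mirror images of points near `y₀` avoid the exceptional point `p`
  have hmirror : ∀ᶠ y in 𝓝 y₀, y ≠ 0 ∧ (l ^ 2 / ‖y‖ ^ 2) • y ≠ p := by
    have h0 : ∀ᶠ y in 𝓝 y₀, y ≠ 0 := isOpen_ne.mem_nhds hyne
    refine h0.and ?_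
    rcases hp with rfl | hp
    · filter_upwards [isOpen_ne.mem_nhds hyne] with y hy using inv_smul_ne_zero hl.ne' hy
    · have hc : ContinuousAt (fun y : EuclideanSpace ℝ (Fin n) => ‖y‖ * ‖p‖) y₀ := by fun_prop
      have h1 : l ^ 2 < ‖y₀‖ * ‖p‖ := by nlinarith
      filter_upwards [isOpen_ne.mem_nhds hyne, hc.eventually (lt_mem_nhds h1)] with y hy h2 h3
      have hy' : 0 < ‖y‖ := norm_pos_iff.mpr hy
      rw [← h3, norm_inv_smul] at h2
      field_simp at h2
      exact lt_irrefl _ h2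
  have hsolζ : ∀ᶠ y in 𝓝 y₀, SolvesAt U F (kelvin l ξ) y := by
    filter_upwards [hmirror] with y hy
    have h1 := inv_smul_ne_zero hl.ne' hy.1
    exact SolvesAt.kelvin hU hF hl.ne' hy.1 (hC _ h1) (hsol _ h1 hy.2)
  have hsolξ : ∀ᶠ y in 𝓝[≠] y₀, SolvesAt U F ξ y := by
    have h1 : ∀ᶠ y in 𝓝[≠] y₀, y ≠ p := by
      by_cases h : y₀ = p
      · rw [← h]; exact self_mem_nhdsWithin
      · exact nhdsWithin_le_nhds (isOpen_ne.mem_nhds h)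
    filter_upwards [h1, nhdsWithin_le_nhds (isOpen_ne.mem_nhds hyne)] with y hy1 hy2
    exact hsol y hy2 hy1
  exact false_of_touching hU hF hyne (hC _ hyne) (contDiffAt_kelvin hyne (hC _ hz)) (hpos _ hyne)
    heq hgrad hsolζ.self_of_nhds.1 (hsolξ.and (hsolζ.filter_mono nhdsWithin_le_nhds))
    (Eventually.of_forall hlt)

/-- Strict reflection inequality outside the sphere: otherwise touch at a point of contact of
maximal norm. -/
lemma lt_kelvin_of_le (hU : AdmissibleSet U) (hF : AdmissibleFun U F)
    (hC : ∀ y ≠ 0, ContDiffAt ℝ 2 ξ y) (hpos : ∀ y ≠ 0, 0 < ξ y)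
    (hsol : ∀ y ≠ 0, y ≠ p → SolvesAt U F ξ y) (hp : p = 0 ∨ l < ‖p‖) (hl : 0 < l)
    (hbelow : ∀ y, l ≤ ‖y‖ → ξ y ≤ kelvin l ξ y) {M : ℝ}
    (hM : ∀ y, M < ‖y‖ → ξ y < kelvin l ξ y) {y : EuclideanSpace ℝ (Fin n)} (hy : l < ‖y‖) :
    ξ y < kelvin l ξ y := by
  refine lt_of_le_of_ne (hbelow y hy.le) fun heq => ?_
  have hne : ∀ x : EuclideanSpace ℝ (Fin n), ‖y‖ ≤ ‖x‖ → x ≠ 0 := fun x hx =>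
    norm_pos_iff.mp ((hl.trans hy).trans_le hx)
  have hK : IsCompact (Metric.closedBall (0 : EuclideanSpace ℝ (Fin n)) M ∩ {x | ‖y‖ ≤ ‖x‖}) :=
    (isCompact_closedBall _ _).inter_right (isClosed_le continuous_const continuous_norm)
  have hcont : ContinuousOn (fun x => ξ x - kelvin l ξ x)
      (Metric.closedBall (0 : EuclideanSpace ℝ (Fin n)) M ∩ {x | ‖y‖ ≤ ‖x‖}) := fun x hx =>
    ((hC x (hne x hx.2)).continuousAt.sub (contDiffAt_kelvin (hne x hx.2)
      (hC _ (inv_smul_ne_zero hl.ne' (hne x hx.2)))).continuousAt).continuousWithinAt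
  have hZ := hK.of_isClosed_subset (hcont.preimage_isClosed_of_isClosed hK.isClosed
    (isClosed_singleton (x := (0 : ℝ)))) inter_subset_left
  have hyM : ‖y‖ ≤ M := by
    by_contra! h
    exact (hM y h).ne heq
  obtain ⟨y₀, hy₀, hmax⟩ := hZ.exists_isMaxOn ⟨y, ⟨by simpa using hyM, le_refl ‖y‖⟩, by simp [heq]⟩
    continuous_norm.continuousOn
  have hy₀l : l < ‖y₀‖ := hy.trans_le hy₀.1.2
  have hy₀ne := hne y₀ hy₀.1.2
  have heq₀ : ξ y₀ = kelvin l ξ y₀ := sub_eq_zero.mp hy₀.2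
  have d1 := (hC y₀ hy₀ne).differentiableAt (by norm_num)
  have d2 := (contDiffAt_kelvin hy₀ne
    (hC _ (inv_smul_ne_zero hl.ne' hy₀ne))).differentiableAt (by norm_num)
  have hlocal : IsLocalMin (fun x => kelvin l ξ x - ξ x) y₀ := by
    filter_upwards [continuous_norm.continuousAt.eventually (lt_mem_nhds hy₀l)] with x hx
    rw [heq₀, sub_self]
    linarith [hbelow x hx.le]
  have hgrad : fderiv ℝ ξ y₀ = fderiv ℝ (kelvin l ξ) y₀ := by
    have h1 := hlocal.fderiv_eq_zero
    have h2 : HasFDerivAt (fun x => kelvin l ξ x - ξ x) _ y₀ := d2.hasFDerivAt.sub d1.hasFDerivAt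
    rw [h2.fderiv] at h1
    exact (sub_eq_zero.mp h1).symm
  refine false_of_touching_kelvin hU hF hC hpos hsol hp hl hy₀l.le heq₀ hgrad fun x hx => ?_
  rcases lt_or_ge M ‖x‖ with h1 | h1
  · exact hM x h1
  · refine lt_of_le_of_ne (hbelow x (hy₀l.trans hx).le) fun h2 => ?_
    have h3 : ‖x‖ ≤ ‖y₀‖ :=
      hmax ⟨⟨by simpa using h1, (hy₀.1.2 : ‖y‖ ≤ ‖y₀‖).trans hx.le⟩, by simp [h2]⟩
    linarith

/-- On the sphere, `ξ (t y) / t` is strictly decreasing at `t = 1`. -/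
lemma fderiv_lt_of_le_kelvin (hU : AdmissibleSet U) (hF : AdmissibleFun U F)
    (hC : ∀ y ≠ 0, ContDiffAt ℝ 2 ξ y) (hpos : ∀ y ≠ 0, 0 < ξ y)
    (hsol : ∀ y ≠ 0, y ≠ p → SolvesAt U F ξ y) (hp : p = 0 ∨ l < ‖p‖) (hl : 0 < l)
    (hlt : ∀ y, l < ‖y‖ → ξ y < kelvin l ξ y) {y : EuclideanSpace ℝ (Fin n)} (hy : ‖y‖ = l) :
    fderiv ℝ ξ y y < ξ y := by
  by_contra! hge
  have hyne : y ≠ 0 := norm_pos_iff.mp (hy ▸ hl)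
  have hz : (l ^ 2 / ‖y‖ ^ 2) • y = y := by
    rw [hy, div_self (by positivity), one_smul]
  have heq : ξ y = kelvin l ξ y := by rw [← hy, kelvin_eq_self hyne]
  have d1 := (hC y hyne).differentiableAt (by norm_num)
  have d2 := hasFDerivAt_kelvin (ξ := ξ) (l := l) hl.ne' hyne (by rwa [hz])
  rw [hz] at d2
  have hle : fderiv ℝ ξ y y ≤ ξ y := by
    have hline : HasDerivAt (fun t : ℝ => y + t • y) y 0 := by
      simpa only [id, one_smul] using ((hasDerivAt_id (0 : ℝ)).smul_const y).const_add y
    have hd : HasDerivAt (fun t : ℝ => kelvin l ξ (y + t • y) - ξ (y + t • y))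
        (2 * (ξ y - fderiv ℝ ξ y y)) 0 := by
      have h1 := d2.sub d1.hasFDerivAt
      refine (h1.comp_hasDerivAt_of_eq 0 hline (by simp)).congr_deriv ?_
      simp [hy]
      field_simp
    have hs := hd.tendsto_slope.mono_left (nhdsGT_le_nhdsNE (0 : ℝ))
    have : 0 ≤ 2 * (ξ y - fderiv ℝ ξ y y) := by
      refine ge_of_tendsto hs ?_
      filter_upwards [self_mem_nhdsWithin] with t ht
      have ht : 0 < t := ht
      rw [slope_def_field]
      simp only [zero_smul, add_zero, sub_zero, ← heq, sub_self]
      have hn : l < ‖y + t • y‖ := by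
        have : y + t • y = (1 + t) • y := by module
        rw [this, norm_smul, Real.norm_eq_abs, abs_of_pos (by linarith), hy]
        nlinarith
      exact div_nonneg (by linarith [hlt _ hn]) ht.le
    linarith
  have hgrad : fderiv ℝ ξ y = fderiv ℝ (kelvin l ξ) y := by
    rw [d2.fderiv, le_antisymm hle hge, sub_self, mul_zero, zero_smul, add_zero]
  exact false_of_touching_kelvin hU hF hC hpos hsol hp hl hy.ge heq hgrad
    fun x hx => hlt x (hy ▸ hx)

/-- The set of radii satisfying the reflection inequality is open to the right. -/
lemma exists_gt_le_kelvin (hU : AdmissibleSet U) (hF : AdmissibleFun U F)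
    (hC : ∀ y ≠ 0, ContDiffAt ℝ 2 ξ y) (hpos : ∀ y ≠ 0, 0 < ξ y)
    (hsol : ∀ y ≠ 0, y ≠ p → SolvesAt U F ξ y) (hp : p = 0 ∨ l < ‖p‖) (hl : 0 < l)
    (hbelow : ∀ y, l ≤ ‖y‖ → ξ y ≤ kelvin l ξ y) {α β : ℝ}
    (hα : 0 < α) (h0 : Tendsto ξ (𝓝[≠] 0) (𝓝 β)) (hinf : Tendsto (kelvin 1 ξ) (𝓝[≠] 0) (𝓝 α))
    (hlt : l ^ 2 * α < β) {b : ℝ} (hb : l < b) :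
    ∃ μ ∈ Ioc l b, ∀ y, μ ≤ ‖y‖ → ξ y ≤ kelvin μ ξ y := by
  obtain ⟨l', hl', M, hM, hMlt⟩ := exists_lt_kelvin_of_norm_gt hα h0 hinf hlt
  have ha := fun y => lt_kelvin_of_le (y := y) hU hF hC hpos hsol hp hl hbelow (hMlt l hl hl'.le)
  have hb' := fun y => fderiv_lt_of_le_kelvin (y := y) hU hF hC hpos hsol hp hl ha
  by_contra! hcon
  obtain ⟨μ, -, hμ, hμlim⟩ := exists_seq_strictAnti_tendsto' (lt_min hb hl')
  have hμ1 : ∀ k, l < μ k := fun k => (hμ k).1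
  have hμ2 : ∀ k, μ k ≤ b := fun k => ((hμ k).2.trans_le (min_le_left _ _)).le
  have hμ3 : ∀ k, μ k ≤ l' := fun k => ((hμ k).2.trans_le (min_le_right _ _)).le
  choose y hy1 hy2 using fun k => hcon (μ k) ⟨hμ1 k, hμ2 k⟩
  have hK : IsCompact (Metric.closedBall (0 : EuclideanSpace ℝ (Fin n)) M ∩ {x | l ≤ ‖x‖}) :=
    (isCompact_closedBall _ _).inter_right (isClosed_le continuous_const continuous_norm)
  have hyK : ∀ k, y k ∈ Metric.closedBall (0 : EuclideanSpace ℝ (Fin n)) M ∩ {x | l ≤ ‖x‖} := by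
    refine fun k => ⟨?_, (hμ1 k).le.trans (hy1 k)⟩
    by_contra h
    rw [mem_closedBall_zero_iff, not_le] at h
    exact lt_asymm (hy2 k) (hMlt (μ k) (hl.trans (hμ1 k)) (hμ3 k) (y k) h)
  obtain ⟨y₀, hy₀, φ, hφ, hylim⟩ := hK.tendsto_subseq hyK
  have hμlim' : Tendsto (μ ∘ φ) atTop (𝓝 l) := hμlim.comp hφ.tendsto_atTop
  have hly₀ : l ≤ ‖y₀‖ := hy₀.2
  have hy₀0 : 0 < ‖y₀‖ := hl.trans_le hly₀
  have hy₀ne : y₀ ≠ 0 := norm_pos_iff.mp hy₀0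
  rcases hly₀.lt_or_eq with h1 | h1
  · have h2 := (continuousAt_kelvin_uncurry hl.ne' hy₀ne
      (hC _ (inv_smul_ne_zero hl.ne' hy₀ne)).continuousAt).tendsto.comp
      (hμlim'.prodMk_nhds hylim)
    have h3 := (hC _ hy₀ne).continuousAt.tendsto.comp hylim
    have := le_of_tendsto_of_tendsto' h2 h3 fun k => (hy2 (φ k)).le
    linarith [ha y₀ h1]
  · choose t ht1 ht2 using fun k =>
      exists_lt_fderiv_of_kelvin_lt hC (hl.trans (hμ1 k)) (hy1 k) (hy2 k)
    have htlim : Tendsto (t ∘ φ) atTop (𝓝 1) := by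
      have h2 : Tendsto (fun k => μ (φ k) ^ 2 / ‖y (φ k)‖ ^ 2) atTop (𝓝 (l ^ 2 / ‖y₀‖ ^ 2)) :=
        (hμlim'.pow 2).div (hylim.norm.pow 2) (by positivity)
      rw [← h1, div_self (by positivity)] at h2
      exact tendsto_of_tendsto_of_tendsto_of_le_of_le h2 tendsto_const_nhds
        (fun k => (ht1 (φ k)).1.le) (fun k => (ht1 (φ k)).2.le)
    have hlim : Tendsto (fun k => t (φ k) • y (φ k)) atTop (𝓝 y₀) := by
      simpa using htlim.smul hylim
    have h3 := (hC _ hy₀ne).continuousAt.tendsto.comp hlim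
    have h4 : ContinuousAt (fun x => fderiv ℝ ξ x x) y₀ :=
      (contDiffAt_fderiv (hC _ hy₀ne)).continuousAt.clm_apply continuousAt_id
    have := le_of_tendsto_of_tendsto' h3 (h4.tendsto.comp hlim) fun k => (ht2 (φ k)).le
    linarith [hb' y₀ h1.symm]

end Continuation

/-- Moving spheres. Let `ξ` solve the equation away from the origin and possibly a point `p`
outside the sphere of radius `Λ`, let it tend to `β` at the origin, with `|y| |∇ξ| → 0`, and be
asymptotic to `α |y|²` at infinity. Then the reflection inequality holds up to the critical radius
`Λ = (β / α) ^ (1 / 2)`. -/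
theorem le_kelvin (hU : AdmissibleSet U) (hF : AdmissibleFun U F)
    {ξ : EuclideanSpace ℝ (Fin n) → ℝ} {p : EuclideanSpace ℝ (Fin n)} {α β Λ : ℝ} (hΛ : 0 < Λ)
    (hC : ∀ y ≠ 0, ContDiffAt ℝ 2 ξ y) (hpos : ∀ y ≠ 0, 0 < ξ y)
    (hsol : ∀ y ≠ 0, y ≠ p → SolvesAt U F ξ y) (hp : p = 0 ∨ Λ ≤ ‖p‖)
    (hα : 0 < α) (hβ : 0 < β) (h0 : Tendsto ξ (𝓝[≠] 0) (𝓝 β))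
    (hg : Tendsto (fun y => ‖y‖ * ‖fderiv ℝ ξ y‖) (𝓝[≠] 0) (𝓝 0))
    (hinf : Tendsto (kelvin 1 ξ) (𝓝[≠] 0) (𝓝 α)) (hle : Λ ^ 2 * α ≤ β) :
    ∀ y, Λ ≤ ‖y‖ → ξ y ≤ kelvin Λ ξ y := by
  obtain ⟨l₀, hl₀, hl₀Λ, hstart⟩ := exists_forall_le_kelvin hΛ hC hα hβ h0 hg hinf hle
  set S : Set ℝ := {l | ∀ y, l ≤ ‖y‖ → ξ y ≤ kelvin l ξ y} with hS
  have hclosed : IsClosed (S ∩ Icc l₀ Λ) := by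
    refine IsSeqClosed.isClosed fun μ l hμ hlim => ?_
    have hl : l ∈ Icc l₀ Λ := isClosed_Icc.mem_of_tendsto hlim (Eventually.of_forall fun k => (hμ k).2)
    refine ⟨fun y hy => ?_, hl⟩
    have hl0 : 0 < l := hl₀.trans_le hl.1
    have hyne : y ≠ 0 := norm_pos_iff.mp (hl0.trans_le hy)
    rcases hy.lt_or_eq with h | h
    · have h2 := (continuousAt_kelvin_uncurry hl0.ne' hyne
        (hC _ (inv_smul_ne_zero hl0.ne' hyne)).continuousAt).tendsto.comp
        (hlim.prodMk_nhds (tendsto_const_nhds (x := y)))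
      refine ge_of_tendsto h2 ?_
      filter_upwards [hlim.eventually (gt_mem_nhds h)] with k hk
      exact (hμ k).1 y hk.le
    · rw [h, kelvin_eq_self hyne]
  have := hclosed.Icc_subset_of_forall_exists_gt hstart fun l hl b hb => ?_
  · exact this ⟨hl₀Λ, le_rfl⟩
  · have hl0 : 0 < l := hl₀.trans_le hl.2.1
    have hlΛ : l ^ 2 * α < Λ ^ 2 * α := by
      have := hl.2.2
      gcongr
    obtain ⟨μ, hμ, hμS⟩ := exists_gt_le_kelvin hU hF hC hpos hsol
      (hp.imp_right hl.2.2.trans_le) hl0 hl.1 hα h0 hinf (hlΛ.trans_le hle) hb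
    exact ⟨μ, hμS, hμ⟩

/-! ### Classification of the solutions -/

lemma kelvin_one_smul {ξ : EuclideanSpace ℝ (Fin n) → ℝ} {y : EuclideanSpace ℝ (Fin n)} {Λ : ℝ}
    (hΛ : Λ ≠ 0) (hy : y ≠ 0) :
    Λ ^ 2 * kelvin 1 ξ ((1 / Λ ^ 2) • y) = kelvin Λ ξ y := by
  have h : ‖y‖ ≠ 0 := by simpa using hy
  have hn : ‖(1 / Λ ^ 2) • y‖ = ‖y‖ / Λ ^ 2 := by
    rw [norm_smul, Real.norm_eq_abs, abs_of_nonneg (by positivity)]; ring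
  rw [kelvin, kelvin, hn, smul_smul]
  have : (1 : ℝ) ^ 2 / (‖y‖ / Λ ^ 2) ^ 2 * (1 / Λ ^ 2) = Λ ^ 2 / ‖y‖ ^ 2 := by field_simp
  rw [this]
  field_simp

/-- Moving spheres started from infinity: the reverse reflection inequality, for an exceptional
point `p` inside the sphere. It is `le_kelvin` for the Kelvin transform of `ξ`. -/
theorem kelvin_le (hU : AdmissibleSet U) (hF : AdmissibleFun U F)
    {ξ : EuclideanSpace ℝ (Fin n) → ℝ} {p : EuclideanSpace ℝ (Fin n)} {α β Λ : ℝ} (hΛ : 0 < Λ)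
    (hC : ∀ y ≠ 0, ContDiffAt ℝ 2 ξ y) (hpos : ∀ y ≠ 0, 0 < ξ y)
    (hsol : ∀ y ≠ 0, y ≠ p → SolvesAt U F ξ y) (hp : ‖p‖ ≤ Λ)
    (hα : 0 < α) (hβ : 0 < β) (h0 : Tendsto ξ (𝓝[≠] 0) (𝓝 β))
    (hinf : Tendsto (kelvin 1 ξ) (𝓝[≠] 0) (𝓝 α))
    (hg : Tendsto (fun y => ‖y‖ * ‖fderiv ℝ (kelvin 1 ξ) y‖) (𝓝[≠] 0) (𝓝 0))
    (hle : β ≤ Λ ^ 2 * α) :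
    ∀ y, Λ ≤ ‖y‖ → kelvin Λ ξ y ≤ ξ y := by
  intro y hy
  have hy0 : 0 < ‖y‖ := hΛ.trans_le hy
  have hyne : y ≠ 0 := norm_pos_iff.mp hy0
  have hinv := fun (y : EuclideanSpace ℝ (Fin n)) (hy : y ≠ 0) =>
    inv_smul_ne_zero (one_ne_zero (α := ℝ)) hy
  have key := le_kelvin hU hF (ξ := kelvin 1 ξ) (p := ((1 : ℝ) ^ 2 / ‖p‖ ^ 2) • p)
    (Λ := 1 / Λ) (α := β) (β := α) (by positivity)
    (fun y hy => contDiffAt_kelvin hy (hC _ (hinv y hy)))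
    (fun y hy => mul_pos (by have := norm_pos_iff.mpr hy; positivity) (hpos _ (hinv y hy)))
    (fun y hy hyp => SolvesAt.kelvin hU hF one_ne_zero hy (hC _ (hinv y hy))
      (hsol _ (hinv y hy) fun h => hyp (by rw [← h, inv_smul_inv_smul one_ne_zero hy])))
    (by
      rcases eq_or_ne p 0 with rfl | hp0
      · left; simp
      · right
        rw [norm_inv_smul, one_pow]
        have := norm_pos_iff.mpr hp0
        gcongr)
    hβ hα hinf hg
    (h0.congr' (by
      filter_upwards [self_mem_nhdsWithin] with y hy
      rw [kelvin_kelvin one_ne_zero hy]))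
    (by
      rw [div_pow, one_pow, one_div, inv_mul_le_iff₀ (by positivity)]; exact hle)
    ((1 / Λ ^ 2) • y) (by
      rw [norm_smul, Real.norm_eq_abs, abs_of_pos (by positivity)]
      calc 1 / Λ = 1 / Λ ^ 2 * Λ := by field_simp
        _ ≤ _ := by gcongr)
  rw [← kelvin_one_smul hΛ.ne' hyne]
  have h1 : (1 / Λ ^ 2) • y ≠ 0 := smul_ne_zero (by positivity) hyne
  rw [← kelvin_one_smul (Λ := 1 / Λ) (by positivity) h1, smul_smul, div_pow, one_pow, one_div_one_div,
    mul_one_div_cancel (by positivity), one_smul, kelvin_kelvin one_ne_zero hyne] at key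
  calc Λ ^ 2 * kelvin 1 ξ ((1 / Λ ^ 2) • y) ≤ Λ ^ 2 * (1 / Λ ^ 2 * ξ y) := by gcongr
    _ = ξ y := by field_simp

lemma tendsto_norm_mul_fderiv {η ζ : EuclideanSpace ℝ (Fin n) → ℝ} (hη : ContDiffAt ℝ 2 η 0)
    (h : ζ =ᶠ[𝓝[≠] 0] η) : Tendsto (fun y => ‖y‖ * ‖fderiv ℝ ζ y‖) (𝓝[≠] 0) (𝓝 0) := by
  have h1 : Tendsto (fun y => ‖y‖ * ‖fderiv ℝ η y‖) (𝓝[≠] 0) (𝓝 0) := by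
    have hc : ContinuousAt (fun y => ‖y‖ * ‖fderiv ℝ η y‖) 0 :=
      continuous_norm.continuousAt.mul (contDiffAt_fderiv hη).continuousAt.norm
    have := hc.tendsto
    rw [norm_zero, zero_mul] at this
    exact this.mono_left nhdsWithin_le_nhds
  refine h1.congr' ?_
  have h2 := eventually_eventually_nhdsWithin.mpr h
  filter_upwards [h2, self_mem_nhdsWithin] with y hy hy0
  rw [isOpen_compl_singleton.nhdsWithin_eq hy0] at hy
  have hy' : ζ =ᶠ[𝓝 y] η := hy
  rw [hy'.fderiv_eq]

/-- Moving spheres about the origin from both ends: a solution that is regular at infinity and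
merely continuous at the origin is invariant under a Kelvin transform. -/
lemma eq_kelvin (hU : AdmissibleSet U) (hF : AdmissibleFun U F)
    {ξ η : EuclideanSpace ℝ (Fin n) → ℝ} {β : ℝ} (hC : ∀ y ≠ 0, ContDiffAt ℝ 2 ξ y)
    (hpos : ∀ y ≠ 0, 0 < ξ y) (hsol : ∀ y ≠ 0, SolvesAt U F ξ y)
    (hβ : 0 < β) (h0 : Tendsto ξ (𝓝[≠] 0) (𝓝 β))
    (hg : Tendsto (fun y => ‖y‖ * ‖fderiv ℝ ξ y‖) (𝓝[≠] 0) (𝓝 0))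
    (hη : ContDiffAt ℝ 2 η 0) (hη0 : 0 < η 0) (hηξ : kelvin 1 ξ =ᶠ[𝓝[≠] 0] η)
    {y : EuclideanSpace ℝ (Fin n)} (hy : y ≠ 0) : ξ y = kelvin √(β / η 0) ξ y := by
  set Λ := √(β / η 0) with hΛdef
  have hΛ : 0 < Λ := Real.sqrt_pos.mpr (by positivity)
  have hΛ2 : Λ ^ 2 * η 0 = β := by
    rw [hΛdef, Real.sq_sqrt (by positivity)]; field_simp
  have hinf : Tendsto (kelvin 1 ξ) (𝓝[≠] 0) (𝓝 (η 0)) :=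
    (hη.continuousAt.tendsto.mono_left nhdsWithin_le_nhds).congr' hηξ.symm
  have h1 := le_kelvin hU hF (p := 0) hΛ hC hpos (fun y hy _ => hsol y hy) (Or.inl rfl) hη0 hβ h0
    hg hinf hΛ2.le
  have h2 := kelvin_le hU hF (p := 0) hΛ hC hpos (fun y hy _ => hsol y hy) (by simpa using hΛ.le)
    hη0 hβ h0 hinf (tendsto_norm_mul_fderiv hη hηξ) hΛ2.ge
  rcases le_or_gt Λ ‖y‖ with h | h
  · exact le_antisymm (h1 y h) (h2 y h)
  · have hy0 := norm_pos_iff.mpr hy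
    have h3 : Λ ≤ ‖(Λ ^ 2 / ‖y‖ ^ 2) • y‖ := by
      rw [norm_inv_smul, le_div_iff₀ hy0]; nlinarith
    have h4 := le_antisymm (h1 _ h3) (h2 _ h3)
    rw [kelvin, h4, kelvin, inv_smul_inv_smul hΛ.ne' hy, norm_inv_smul]
    field_simp

lemma schouten_comp_add (ξ : EuclideanSpace ℝ (Fin n) → ℝ) (x y : EuclideanSpace ℝ (Fin n)) :
    schouten (fun y => ξ (x + y)) y = schouten ξ (x + y) := by
  have h : fderiv ℝ (fun y => ξ (x + y)) = fun y => fderiv ℝ ξ (x + y) := by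
    ext1 y; exact fderiv_comp_add_left x
  rw [schouten, h, fderiv_comp_add_left]
  rfl

/-- Regularity at infinity is invariant under translations; the first derivative of the
inversion changes by a multiple of the translation vector. -/
lemma exists_kelvin_comp_add {ξ η : EuclideanSpace ℝ (Fin n) → ℝ} (hη : ContDiffAt ℝ 2 η 0)
    (hηξ : kelvin 1 ξ =ᶠ[𝓝[≠] 0] η) (x : EuclideanSpace ℝ (Fin n)) :
    ∃ ζ : EuclideanSpace ℝ (Fin n) → ℝ, ContDiffAt ℝ 2 ζ 0 ∧ ζ 0 = η 0 ∧
      fderiv ℝ ζ 0 = (2 * η 0) • innerSL ℝ x + fderiv ℝ η 0 ∧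
      kelvin 1 (fun y => ξ (x + y)) =ᶠ[𝓝[≠] 0] ζ := by
  -- inversion conjugates the translation by `x` to `y ↦ (y + |y|² x) / q y`
  set q : EuclideanSpace ℝ (Fin n) → ℝ := fun y => 1 + 2 * inner ℝ x y + ‖x‖ ^ 2 * ‖y‖ ^ 2 with hq
  set T : EuclideanSpace ℝ (Fin n) → EuclideanSpace ℝ (Fin n) :=
    fun y => (q y)⁻¹ • (y + ‖y‖ ^ 2 • x) with hT
  have hq0 : q 0 = 1 := by simp [hq]
  have hT0 : T 0 = 0 := by simp [hT]
  have hqC : ContDiff ℝ 2 q :=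
    (contDiff_const.add (contDiff_const.mul (contDiff_const.inner ℝ contDiff_id))).add
      (contDiff_const.mul (contDiff_norm_sq ℝ))
  have hqinv : ContDiffAt ℝ 2 (fun y => (q y)⁻¹) 0 := hqC.contDiffAt.inv (by simp [hq0])
  have hTC : ContDiffAt ℝ 2 T 0 :=
    hqinv.smul (contDiffAt_id.add ((contDiff_norm_sq ℝ).contDiffAt.smul contDiffAt_const))
  have hηT : ContDiffAt ℝ 2 (fun y => η (T y)) 0 := ContDiffAt.comp 0 (by rwa [hT0]) hTC
  have hn0 : HasFDerivAt (fun y : EuclideanSpace ℝ (Fin n) => ‖y‖ ^ 2)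
      (0 : EuclideanSpace ℝ (Fin n) →L[ℝ] ℝ) 0 := by
    refine (hasStrictFDerivAt_norm_sq (0 : EuclideanSpace ℝ (Fin n))).hasFDerivAt.congr_fderiv ?_
    ext; simp
  have hqd : HasFDerivAt q ((2 : ℝ) • innerSL ℝ x) 0 := by
    have h1 : HasFDerivAt (fun y => inner ℝ x y) (innerSL ℝ x) 0 := (innerSL ℝ x).hasFDerivAt
    refine (((h1.const_mul 2).const_add 1).add (hn0.const_mul (‖x‖ ^ 2))).congr_fderiv ?_
    simp
  have hTd : HasFDerivAt T (ContinuousLinearMap.id ℝ _) 0 := by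
    have h1 := hqinv.differentiableAt (by norm_num) |>.hasFDerivAt
    refine (h1.smul ((hasFDerivAt_id _).add (hn0.smul (hasFDerivAt_const x _)))).congr_fderiv ?_
    ext b
    simp [hq0]
  refine ⟨fun y => q y * η (T y), hqC.contDiffAt.mul hηT, by simp [hq0, hT0], ?_, ?_⟩
  · have h1 : HasFDerivAt η (fderiv ℝ η 0) (T 0) := by
      rw [hT0]; exact (hη.differentiableAt (by norm_num)).hasFDerivAt
    have h2 := hqd.mul (h1.comp 0 hTd)
    have h3 : HasFDerivAt (fun y => q y * η (T y)) _ 0 := h2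
    rw [h3.fderiv]
    ext b
    simp [hq0, hT0]
    ring
  · have hTne : ∀ᶠ y in 𝓝[≠] 0, T y ≠ 0 ∧ kelvin 1 ξ (T y) = η (T y) := by
      have h1 : ∀ᶠ y in 𝓝[≠] (0 : EuclideanSpace ℝ (Fin n)), T y ≠ T 0 :=
        hTd.eventually_ne (c := T 0) ⟨1, fun z => by simp⟩
      rw [hT0] at h1
      have h2 : Tendsto T (𝓝[≠] 0) (𝓝[≠] 0) := by
        refine tendsto_nhdsWithin_iff.mpr ⟨?_, h1⟩
        have := hTd.continuousAt.tendsto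
        rw [hT0] at this
        exact this.mono_left nhdsWithin_le_nhds
      exact h1.and (h2.eventually hηξ)
    have hq1 : ∀ᶠ y in 𝓝[≠] (0 : EuclideanSpace ℝ (Fin n)), 0 < q y :=
      (hqC.continuous.continuousAt.eventually (lt_mem_nhds (by simp [hq0]))).filter_mono
        nhdsWithin_le_nhds
    filter_upwards [hTne, hq1, self_mem_nhdsWithin] with y hy hqy hy0
    have hy0 : y ≠ 0 := hy0
    have hyn : 0 < ‖y‖ := norm_pos_iff.mpr hy0
    have hnT : ‖T y‖ ^ 2 = ‖y‖ ^ 2 / q y := by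
      rw [hT]
      simp only
      rw [norm_smul, mul_pow, Real.norm_eq_abs, sq_abs, norm_add_sq_real, inner_smul_right,
        norm_smul, real_inner_comm]
      have : ‖y‖ ^ 2 + 2 * (‖y‖ ^ 2 * inner ℝ x y) + (‖‖y‖ ^ 2‖ * ‖x‖) ^ 2 = ‖y‖ ^ 2 * q y := by
        rw [Real.norm_eq_abs, abs_of_nonneg (by positivity), hq]; ring
      rw [this]
      field_simp
    rw [← hy.2, kelvin, kelvin, hnT]
    have hpt : ((1 : ℝ) ^ 2 / (‖y‖ ^ 2 / q y)) • T y = x + ((1 : ℝ) ^ 2 / ‖y‖ ^ 2) • y := by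
      rw [hT]
      simp only [smul_smul, smul_add]
      rw [add_comm]
      congr 1
      · convert one_smul ℝ x using 2; field_simp
      · congr 1; field_simp
    rw [hpt]
    field_simp

/-- The derivative of a solution at `x`, read off from moving spheres about `x`. The spheres start
at `x` or at infinity, according to the position of the exceptional point `0`; in both cases the
reflection inequality at the critical radius is an equality at infinity, so the derivatives there
agree. -/
lemma fderiv_eq_of_solves (hU : AdmissibleSet U) (hF : AdmissibleFun U F)
    {ξ η : EuclideanSpace ℝ (Fin n) → ℝ} (hC : ∀ y, ContDiffAt ℝ 2 ξ y)
    (hpos : ∀ y, 0 < ξ y) (hsol : ∀ y ≠ 0, SolvesAt U F ξ y)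
    (hη : ContDiffAt ℝ 2 η 0) (hη0 : 0 < η 0) (hηξ : kelvin 1 ξ =ᶠ[𝓝[≠] 0] η)
    (x : EuclideanSpace ℝ (Fin n)) :
    fderiv ℝ ξ x = (2 * η 0) • innerSL ℝ x + fderiv ℝ η 0 := by
  obtain ⟨ζ, hζ, hζ0, hζd, hζξ⟩ := exists_kelvin_comp_add hη hηξ x
  set Λ := √(ξ x / η 0) with hΛdef
  have hξx := hpos x
  have hΛ : 0 < Λ := Real.sqrt_pos.mpr (by positivity)
  have hΛ2 : Λ ^ 2 * η 0 = ξ x := by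
    rw [hΛdef, Real.sq_sqrt (by positivity)]; field_simp
  have hC' : ∀ y, ContDiffAt ℝ 2 (fun y => ξ (x + y)) y := fun y =>
    ContDiffAt.comp y (hC (x + y)) (contDiffAt_const.add contDiffAt_id)
  have hsol' : ∀ y ≠ 0, y ≠ -x → SolvesAt U F (fun y => ξ (x + y)) y := fun y _ hy => by
    rw [SolvesAt, schouten_comp_add]
    exact hsol _ fun h => hy (eq_neg_of_add_eq_zero_right h)
  have h0 : Tendsto (fun y => ξ (x + y)) (𝓝[≠] 0) (𝓝 (ξ x)) := by
    have := (hC' 0).continuousAt.tendsto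
    rw [add_zero] at this
    exact this.mono_left nhdsWithin_le_nhds
  have hinf : Tendsto (kelvin 1 fun y => ξ (x + y)) (𝓝[≠] 0) (𝓝 (η 0)) := by
    rw [← hζ0]
    exact (hζ.continuousAt.tendsto.mono_left nhdsWithin_le_nhds).congr' hζξ.symm
  have hd : HasFDerivAt (fun y => (Λ ^ 2)⁻¹ * ξ (x + Λ ^ 2 • y) - ζ y)
      (fderiv ℝ ξ x - fderiv ℝ ζ 0) 0 := by
    have h1 : HasFDerivAt (fun y : EuclideanSpace ℝ (Fin n) => x + Λ ^ 2 • y)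
        (Λ ^ 2 • ContinuousLinearMap.id ℝ (EuclideanSpace ℝ (Fin n))) 0 :=
      ((hasFDerivAt_id _).const_smul (Λ ^ 2)).const_add x
    have h2 : HasFDerivAt ξ (fderiv ℝ ξ x) (x + Λ ^ 2 • (0 : EuclideanSpace ℝ (Fin n))) := by
      rw [smul_zero, add_zero]; exact ((hC x).differentiableAt (by norm_num)).hasFDerivAt
    refine (((h2.comp 0 h1).const_mul (Λ ^ 2)⁻¹).sub
      (hζ.differentiableAt (by norm_num)).hasFDerivAt).congr_fderiv ?_
    ext b
    simp
    field_simp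
  have hval : (Λ ^ 2)⁻¹ * ξ (x + Λ ^ 2 • (0 : EuclideanSpace ℝ (Fin n))) - ζ 0 = 0 := by
    rw [smul_zero, add_zero, hζ0, ← hΛ2]; field_simp; ring
  -- for small `y`, the reflection inequality at `y / |y|²` compares `ζ y` with `ξ (x + Λ² y) / Λ²`
  have hrefl : ∀ᶠ y in 𝓝 (0 : EuclideanSpace ℝ (Fin n)), y = 0 ∨ ∃ z, Λ ≤ ‖z‖ ∧ ∃ c > 0,
      c * ξ (x + z) = ζ y ∧
      c * kelvin Λ (fun y => ξ (x + y)) z = (Λ ^ 2)⁻¹ * ξ (x + Λ ^ 2 • y) := by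
    have hev := eventually_nhdsWithin_iff.mp hζξ
    have hsmall : ∀ᶠ y in 𝓝 (0 : EuclideanSpace ℝ (Fin n)), Λ * ‖y‖ < 1 := by
      have : Continuous fun y : EuclideanSpace ℝ (Fin n) => Λ * ‖y‖ := by fun_prop
      exact this.continuousAt.eventually (gt_mem_nhds (by simp))
    filter_upwards [hev, hsmall] with y hy1 hy2
    rcases eq_or_ne y 0 with h | h
    · exact Or.inl h
    · refine Or.inr ⟨((1 : ℝ) ^ 2 / ‖y‖ ^ 2) • y, ?_, ‖y‖ ^ 2, ?_, ?_, ?_⟩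
      · have := norm_pos_iff.mpr h
        rw [norm_inv_smul, le_div_iff₀ this]; linarith
      · have := norm_pos_iff.mpr h
        positivity
      · rw [← hy1 h, kelvin]; simp
      · have hyn : ‖y‖ ≠ 0 := (norm_pos_iff.mpr h).ne'
        rw [kelvin, norm_inv_smul, smul_smul]
        have : Λ ^ 2 / ((1 : ℝ) ^ 2 / ‖y‖) ^ 2 * (1 ^ 2 / ‖y‖ ^ 2) = Λ ^ 2 := by field_simp
        rw [this]
        field_simp
  rw [← hζd, ← sub_eq_zero]
  rcases le_or_gt Λ ‖x‖ with hcase | hcase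
  · have h1 := le_kelvin hU hF (p := -x) hΛ (fun y _ => hC' y) (fun y _ => hpos _) hsol'
      (Or.inr (by rwa [norm_neg])) hη0 hξx h0
      (tendsto_norm_mul_fderiv (hC' 0) EventuallyEq.rfl) hinf hΛ2.le
    refine IsLocalMin.hasFDerivAt_eq_zero ?_ hd
    filter_upwards [hrefl] with y hy
    rw [hval]
    rcases hy with rfl | ⟨z, hz, c, hc, e1, e2⟩
    · rw [hval]
    · rw [← e1, ← e2, ← mul_sub]
      exact mul_nonneg hc.le (sub_nonneg.mpr (h1 z hz))
  · have h1 := kelvin_le hU hF (p := -x) hΛ (fun y _ => hC' y) (fun y _ => hpos _) hsol'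
      (by rw [norm_neg]; exact hcase.le) hη0 hξx h0 hinf (tendsto_norm_mul_fderiv hζ hζξ) hΛ2.ge
    refine IsLocalMax.hasFDerivAt_eq_zero ?_ hd
    filter_upwards [hrefl] with y hy
    rw [hval]
    rcases hy with rfl | ⟨z, hz, c, hc, e1, e2⟩
    · rw [hval]
    · rw [← e1, ← e2, ← mul_sub]
      exact mul_nonpos_of_nonneg_of_nonpos hc.le (sub_nonpos.mpr (h1 z hz))

/-- The Liouville theorem in the variable `ξ`: solutions are quadratic polynomials. -/
theorem exists_eq_quadratic (hU : AdmissibleSet U) (hF : AdmissibleFun U F)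
    {ξ η : EuclideanSpace ℝ (Fin n) → ℝ} {β : ℝ} (hC : ∀ y ≠ 0, ContDiffAt ℝ 2 ξ y)
    (hpos : ∀ y ≠ 0, 0 < ξ y) (hsol : ∀ y ≠ 0, SolvesAt U F ξ y)
    (hβ : 0 < β) (h0 : Tendsto ξ (𝓝[≠] 0) (𝓝 β))
    (hg : Tendsto (fun y => ‖y‖ * ‖fderiv ℝ ξ y‖) (𝓝[≠] 0) (𝓝 0))
    (hη : ContDiffAt ℝ 2 η 0) (hη0 : 0 < η 0) (hηξ : kelvin 1 ξ =ᶠ[𝓝[≠] 0] η) :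
    ∃ (xbar : EuclideanSpace ℝ (Fin n)) (α m : ℝ), 0 < α ∧ 0 < m ∧
      ∀ x, x ≠ 0 → ξ x = α * ‖x - xbar‖ ^ 2 + m := by
  set Λ := √(β / η 0) with hΛdef
  have hΛ : 0 < Λ := Real.sqrt_pos.mpr (by positivity)
  have hΛ2 : Λ ^ 2 * η 0 = β := by
    rw [hΛdef, Real.sq_sqrt (by positivity)]; field_simp
  -- the symmetry shows that `ξ` extends to a function of class `C²` at the origin
  set f : EuclideanSpace ℝ (Fin n) → ℝ := Function.update ξ 0 β with hf
  have hfξ : ∀ y, y ≠ 0 → f y = ξ y := fun y hy => Function.update_of_ne hy _ _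
  have hfev : ∀ y, y ≠ 0 → f =ᶠ[𝓝 y] ξ := fun y hy => by
    filter_upwards [isOpen_ne.mem_nhds hy] with x hx using hfξ x hx
  have hfC : ∀ y, ContDiffAt ℝ 2 f y := by
    intro y
    rcases eq_or_ne y 0 with rfl | hy
    · have h1 : ContDiffAt ℝ 2 (fun y => Λ ^ 2 * η ((1 / Λ ^ 2) • y)) 0 :=
        contDiffAt_const.mul (ContDiffAt.comp (f := fun y => (1 / Λ ^ 2) • y) 0 (by simpa using hη)
          (contDiff_const_smul (1 / Λ ^ 2)).contDiffAt)
      refine h1.congr_of_eventuallyEq ?_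
      have h2 : Tendsto (fun y : EuclideanSpace ℝ (Fin n) => (1 / Λ ^ 2) • y) (𝓝 0) (𝓝 0) := by
        have : Continuous fun y : EuclideanSpace ℝ (Fin n) => (1 / Λ ^ 2) • y := by fun_prop
        simpa using this.tendsto 0
      filter_upwards [h2.eventually (eventually_nhdsWithin_iff.mp hηξ)] with y hy
      rcases eq_or_ne y 0 with rfl | hy0
      · simp [hf, hΛ2]
      · rw [hfξ y hy0, ← hy (smul_ne_zero (by positivity) hy0), kelvin_one_smul hΛ.ne' hy0]
        exact eq_kelvin hU hF hC hpos hsol hβ h0 hg hη hη0 hηξ hy0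
    · exact (hC y hy).congr_of_eventuallyEq (hfev y hy)
  have hfpos : ∀ y, 0 < f y := by
    intro y
    rcases eq_or_ne y 0 with rfl | hy
    · simpa [hf] using hβ
    · rw [hfξ y hy]; exact hpos y hy
  have hfsol : ∀ y ≠ 0, SolvesAt U F f y := fun y hy => by
    rw [SolvesAt, schouten_congr (hfev y hy)]; exact hsol y hy
  have hηf : kelvin 1 f =ᶠ[𝓝[≠] 0] η := by
    filter_upwards [hηξ, self_mem_nhdsWithin] with y hy hy0
    rw [← hy, kelvin, kelvin, hfξ _ (inv_smul_ne_zero one_ne_zero hy0)]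
  have hgrad := fderiv_eq_of_solves hU hF hfC hfpos hfsol hη hη0 hηf
  obtain ⟨g, hgη⟩ := (InnerProductSpace.toDual ℝ (EuclideanSpace ℝ (Fin n))).surjective
    (fderiv ℝ η 0)
  set xbar : EuclideanSpace ℝ (Fin n) := (-(1 / (2 * η 0))) • g with hxbar
  have hderiv : ∀ x, HasFDerivAt (fun x => f x - η 0 * ‖x - xbar‖ ^ 2)
      (0 : EuclideanSpace ℝ (Fin n) →L[ℝ] ℝ) x := by
    intro x
    have h1 := ((hfC x).differentiableAt (by norm_num)).hasFDerivAt
    have h2 := (hasStrictFDerivAt_norm_sq (x - xbar)).hasFDerivAt.comp x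
      ((hasFDerivAt_id x).sub_const xbar)
    refine (h1.sub (h2.const_mul (η 0))).congr_fderiv ?_
    rw [hgrad, ← hgη]
    ext b
    simp [hxbar]
    field_simp
    ring
  have hconst : ∀ x, f x - η 0 * ‖x - xbar‖ ^ 2 = f xbar := by
    intro x
    have := is_const_of_fderiv_eq_zero (𝕜 := ℝ) (f := fun x => f x - η 0 * ‖x - xbar‖ ^ 2)
      (fun x => (hderiv x).differentiableAt) (fun x => (hderiv x).fderiv) x xbar
    simpa using this
  refine ⟨xbar, η 0, f xbar, hη0, hfpos _, fun x hx => ?_⟩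
  rw [← hfξ x hx, ← hconst x]; ring

/-! ### From `u` to `ξ` -/

section RpowDerivatives

variable {u : EuclideanSpace ℝ (Fin n) → ℝ} {x : EuclideanSpace ℝ (Fin n)}

lemma contDiffAt_rpow_comp (hu : ContDiffAt ℝ 2 u x) (hx : 0 < u x) (γ : ℝ) :
    ContDiffAt ℝ 2 (fun y => u y ^ γ) x :=
  hu.rpow_const_of_ne hx.ne'

lemma fderiv_rpow_comp (hu : DifferentiableAt ℝ u x) (hx : 0 < u x) (γ : ℝ) :
    fderiv ℝ (fun y => u y ^ γ) x = (γ * u x ^ (γ - 1)) • fderiv ℝ u x :=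
  (hu.hasFDerivAt.rpow_const (Or.inl hx.ne')).fderiv

lemma fderiv_fderiv_rpow_comp (hu : ContDiffAt ℝ 2 u x) (hx : 0 < u x) (γ : ℝ)
    (a b : EuclideanSpace ℝ (Fin n)) :
    fderiv ℝ (fderiv ℝ fun y => u y ^ γ) x a b
      = γ * u x ^ (γ - 1) * fderiv ℝ (fderiv ℝ u) x a b
        + γ * (γ - 1) * u x ^ (γ - 2) * (fderiv ℝ u x a * fderiv ℝ u x b) := by
  have hev : fderiv ℝ (fun y => u y ^ γ) =ᶠ[𝓝 x]
      fun y => (γ * u y ^ (γ - 1)) • fderiv ℝ u y := by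
    filter_upwards [hu.eventually (by simp), hu.continuousAt.eventually (lt_mem_nhds hx)]
      with y hy1 hy2
    exact fderiv_rpow_comp (hy1.differentiableAt (by norm_num)) hy2 γ
  have h1 : HasFDerivAt (fun y => γ * u y ^ (γ - 1)) _ x :=
    ((hu.differentiableAt (by norm_num)).hasFDerivAt.rpow_const
      (p := γ - 1) (Or.inl hx.ne')).const_mul γ
  have h2 : HasFDerivAt (fun y => (γ * u y ^ (γ - 1)) • fderiv ℝ u y) _ x :=
    h1.smul (hasFDerivAt_fderiv hu)
  rw [hev.fderiv_eq, h2.fderiv]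
  have h3 : γ - 1 - 1 = γ - 2 := by ring
  simp [h3]
  ring

end RpowDerivatives

lemma norm_sq_eq_sum_sq (L : EuclideanSpace ℝ (Fin n) →L[ℝ] ℝ) :
    ‖L‖ ^ 2 = ∑ k, L (EuclideanSpace.single k 1) ^ 2 := by
  obtain ⟨g, rfl⟩ := (InnerProductSpace.toDual ℝ (EuclideanSpace ℝ (Fin n))).surjective L
  rw [LinearIsometryEquiv.norm_map, EuclideanSpace.real_norm_sq_eq]
  simp [EuclideanSpace.inner_single_right]

/-- The substitution `ξ = u ^ (-2 / (n - 2))` turns the conformal Hessian into `schouten ξ`. -/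
lemma schouten_rpow_eq_confHess (hn : 3 ≤ n) {u : EuclideanSpace ℝ (Fin n) → ℝ}
    {x : EuclideanSpace ℝ (Fin n)} (hu : ContDiffAt ℝ 2 u x) (hx : 0 < u x) :
    (schouten (fun y => u y ^ (-(2 / ((n : ℝ) - 2)))) x : Matrix (Fin n) (Fin n) ℝ)
      = confHess u x := by
  have hn3 : (3 : ℝ) ≤ n := by exact_mod_cast hn
  have hn2 : (n : ℝ) - 2 ≠ 0 := by linarith
  set γ : ℝ := -(2 / ((n : ℝ) - 2)) with hγ
  have e1 : -(((n : ℝ) + 2) / ((n : ℝ) - 2)) = γ + (γ - 1) := by rw [hγ]; field_simp; ring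
  have e2 : -(2 * (n : ℝ) / ((n : ℝ) - 2)) = γ + (γ - 2) := by rw [hγ]; field_simp; ring
  have e3 : u x ^ (γ + (γ - 2)) = (u x ^ (γ - 1)) ^ 2 := by
    rw [← Real.rpow_natCast, ← Real.rpow_mul hx.le]; congr 1; push_cast; ring
  have hsymm : ∀ a b, fderiv ℝ (fderiv ℝ u) x a b = fderiv ℝ (fderiv ℝ u) x b a := fun a b =>
    (hu.isSymmSndFDerivAt (by simp)).eq a b
  have hpd : ∀ i j, partialD (partialD u j) i x = fderiv ℝ (fderiv ℝ u) x
      (EuclideanSpace.single i 1) (EuclideanSpace.single j 1) := by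
    intro i j
    have h1 : HasFDerivAt (partialD u j) _ x :=
      (hasFDerivAt_fderiv hu).clm_apply (hasFDerivAt_const (EuclideanSpace.single j (1 : ℝ)) x)
    rw [partialD, h1.fderiv]
    simp
  have hnorm : ‖fderiv ℝ (fun y => u y ^ γ) x‖ ^ 2
      = γ ^ 2 * u x ^ (γ + (γ - 2)) * ∑ k, partialD u k x ^ 2 := by
    rw [fderiv_rpow_comp (hu.differentiableAt (by norm_num)) hx, norm_smul, mul_pow,
      Real.norm_eq_abs, sq_abs, norm_sq_eq_sum_sq, mul_pow, e3]
    rfl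
  ext i j
  have hL : (schouten (fun y => u y ^ γ) x : Matrix (Fin n) (Fin n) ℝ) i j
      = u x ^ γ * ((fderiv ℝ (fderiv ℝ fun y => u y ^ γ) x (EuclideanSpace.single i 1)
        (EuclideanSpace.single j 1) + fderiv ℝ (fderiv ℝ fun y => u y ^ γ) x
        (EuclideanSpace.single j 1) (EuclideanSpace.single i 1)) / 2)
        - ‖fderiv ℝ (fun y => u y ^ γ) x‖ ^ 2 / 2 * (1 : Matrix (Fin n) (Fin n) ℝ) i j := by
    simp [schouten, symForm, idMat]
  rw [hL, hnorm, fderiv_fderiv_rpow_comp hu hx, fderiv_fderiv_rpow_comp hu hx,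
    hsymm (EuclideanSpace.single j 1)]
  simp only [confHess, Matrix.sub_apply, Matrix.add_apply, Matrix.smul_apply, Matrix.of_apply,
    smul_eq_mul, hpd, e1, e2, Real.rpow_add hx γ]
  have hp : ∀ k, fderiv ℝ u x (EuclideanSpace.single k 1) = partialD u k x := fun k => rfl
  rw [hp, hp]
  have c1 : 2 * (n : ℝ) / ((n : ℝ) - 2) ^ 2 = γ * (γ - 1) := by rw [hγ]; field_simp; ring
  have c2 : 2 / ((n : ℝ) - 2) ^ 2 = γ ^ 2 / 2 := by rw [hγ]; field_simp
  rw [c1, c2]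
  ring

/-- A solution on the punctured space is a bubble. A solution on the whole space is a special case,
its value at the origin being recovered by continuity. -/
theorem exists_eq_bubble (hn : 3 ≤ n) (hU : AdmissibleSet U) (hF : AdmissibleFun U F)
    {u : EuclideanSpace ℝ (Fin n) → ℝ} (huC : ContDiffOn ℝ 2 u {0}ᶜ) (hpos : ∀ x, x ≠ 0 → 0 < u x)
    (hext : ExtendsContinuouslyPos u)
    (hgrad : Tendsto (fun x => ‖x‖ * ‖gradient u x‖) (𝓝[≠] 0) (𝓝 0))
    (hsol : SolvesOn U F u {0}ᶜ) (hreg : RegularAtInfinity u) :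
    ∃ (xbar : EuclideanSpace ℝ (Fin n)) (a b : ℝ), 0 < a ∧ 0 < b ∧
      ∀ x, x ≠ 0 → u x = (a / (1 + b ^ 2 * ‖x - xbar‖ ^ 2)) ^ (((n : ℝ) - 2) / 2) := by
  have hn3 : (3 : ℝ) ≤ n := by exact_mod_cast hn
  have hn2 : (n : ℝ) - 2 ≠ 0 := by linarith
  set γ : ℝ := -(2 / ((n : ℝ) - 2)) with hγ
  set ξ : EuclideanSpace ℝ (Fin n) → ℝ := fun y => u y ^ γ with hξ
  have hu : ∀ y, y ≠ 0 → ContDiffAt ℝ 2 u y := fun y hy =>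
    huC.contDiffAt (isOpen_compl_singleton.mem_nhds hy)
  obtain ⟨r, hr, w, hwC, hwpos, hwu⟩ := hext
  obtain ⟨s, hs, v, hvC, hvpos, hvu⟩ := hreg
  have hw0 : 0 < w 0 := hwpos 0 (Metric.mem_ball_self hr)
  have hv0 : 0 < v 0 := hvpos 0 (Metric.mem_ball_self hs)
  have hulim : Tendsto u (𝓝[≠] 0) (𝓝 (w 0)) := by
    have h1 : ContinuousAt w 0 := hwC.continuousAt (Metric.ball_mem_nhds 0 hr)
    refine (h1.tendsto.mono_left nhdsWithin_le_nhds).congr' ?_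
    filter_upwards [self_mem_nhdsWithin, nhdsWithin_le_nhds (Metric.ball_mem_nhds 0 hr)]
      with y hy hyr using hwu y hyr hy
  have hvC0 : ContDiffAt ℝ 2 v 0 := hvC.contDiffAt (Metric.ball_mem_nhds 0 hs)
  obtain ⟨xbar, α, m, hα, hm, hform⟩ := exists_eq_quadratic hU hF (ξ := ξ) (β := w 0 ^ γ)
    (η := fun y => v y ^ γ) (fun y hy => contDiffAt_rpow_comp (hu y hy) (hpos y hy) γ)
    (fun y hy => Real.rpow_pos_of_pos (hpos y hy) γ)
    (fun y hy => by
      obtain ⟨M, hMU, hM, hM1⟩ := hsol y hy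
      have : schouten ξ y = M :=
        Subtype.ext ((schouten_rpow_eq_confHess hn (hu y hy) (hpos y hy)).trans hM.symm)
      rw [SolvesAt, this]
      exact ⟨hMU, hM1⟩)
    (Real.rpow_pos_of_pos hw0 γ) (hulim.rpow_const (Or.inl hw0.ne'))
    (by
      have h1 : Tendsto (fun y => |γ| * u y ^ (γ - 1) * (‖y‖ * ‖gradient u y‖)) (𝓝[≠] 0)
          (𝓝 (|γ| * w 0 ^ (γ - 1) * 0)) :=
        ((hulim.rpow_const (Or.inl hw0.ne')).const_mul _).mul hgrad
      rw [mul_zero] at h1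
      refine h1.congr' ?_
      filter_upwards [self_mem_nhdsWithin] with y hy
      have hgn : ‖gradient u y‖ = ‖fderiv ℝ u y‖ := LinearIsometryEquiv.norm_map _ _
      rw [hξ, fderiv_rpow_comp ((hu y hy).differentiableAt (by norm_num)) (hpos y hy), norm_smul,
        Real.norm_eq_abs, abs_mul, abs_of_pos (Real.rpow_pos_of_pos (hpos y hy) (γ - 1)), hgn]
      ring)
    (contDiffAt_rpow_comp hvC0 hv0 γ) (Real.rpow_pos_of_pos hv0 γ)
    (by
      filter_upwards [self_mem_nhdsWithin, nhdsWithin_le_nhds (Metric.ball_mem_nhds 0 hs)]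
        with y hy hys
      have hy : y ≠ 0 := hy
      have hyn : 0 < ‖y‖ := norm_pos_iff.mpr hy
      have hz := inv_smul_ne_zero (one_ne_zero (α := ℝ)) hy
      rw [one_pow] at hz
      rw [hvu y hys hy, Real.mul_rpow (by positivity) (hpos _ hz).le, ← Real.rpow_mul hyn.le]
      have e : (2 - (n : ℝ)) * γ = (2 : ℕ) := by rw [hγ]; push_cast; field_simp; ring
      rw [e, Real.rpow_natCast, kelvin, hξ]
      simp)
  refine ⟨xbar, 1 / m, √(α / m), by positivity, Real.sqrt_pos.mpr (by positivity), fun x hx => ?_⟩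
  have hux := hpos x hx
  have h1 : u x = (ξ x) ^ (-(((n : ℝ) - 2) / 2)) := by
    rw [hξ]
    simp only
    rw [← Real.rpow_mul hux.le]
    have : γ * -(((n : ℝ) - 2) / 2) = 1 := by rw [hγ]; field_simp
    rw [this, Real.rpow_one]
  have hξx : 0 < ξ x := Real.rpow_pos_of_pos hux γ
  rw [h1, Real.rpow_neg hξx.le, ← Real.inv_rpow hξx.le, Real.sq_sqrt (by positivity), hform x hx]
  congr 1
  field_simp
  ring

end

end ConformalLiouville

theorem theorem1 (n : ℕ) (hn : 3 ≤ n)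
    (U : Set (ConformalLiouville.SymMat n)) (hU : ConformalLiouville.AdmissibleSet U)
    (F : ConformalLiouville.SymMat n → ℝ) (hF : ConformalLiouville.AdmissibleFun U F) :
    (∀ u : EuclideanSpace ℝ (Fin n) → ℝ,
      ContDiff ℝ 2 u → (∀ x, 0 < u x) →
      ConformalLiouville.SolvesOn U F u Set.univ →
      ConformalLiouville.RegularAtInfinity u →
      ∃ (xbar : EuclideanSpace ℝ (Fin n)) (a b : ℝ), 0 < a ∧ 0 < b ∧
        ∀ x, u x = (a / (1 + b ^ 2 * ‖x - xbar‖ ^ 2)) ^ (((n : ℝ) - 2) / 2)) ∧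
    (∀ u : EuclideanSpace ℝ (Fin n) → ℝ,
      ContDiffOn ℝ 2 u {0}ᶜ → (∀ x, x ≠ 0 → 0 < u x) →
      ConformalLiouville.ExtendsContinuouslyPos u →
      Tendsto (fun x => ‖x‖ * ‖gradient u x‖) (𝓝[≠] 0) (𝓝 0) →
      ConformalLiouville.SolvesOn U F u {0}ᶜ →
      ConformalLiouville.RegularAtInfinity u →
      ∃ (xbar : EuclideanSpace ℝ (Fin n)) (a b : ℝ), 0 < a ∧ 0 < b ∧
        ∀ x, x ≠ 0 → u x = (a / (1 + b ^ 2 * ‖x - xbar‖ ^ 2)) ^ (((n : ℝ) - 2) / 2)) := by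
  have part2 := fun (u : EuclideanSpace ℝ (Fin n) → ℝ) =>
    ConformalLiouville.exists_eq_bubble (u := u) hn hU hF
  refine ⟨fun u huC hpos hsol hreg => ?_, fun u huC hpos hext hgrad hsol hreg =>
    part2 u huC hpos hext hgrad hsol hreg⟩
  have hgrad : Tendsto (fun x => ‖x‖ * ‖gradient u x‖) (𝓝[≠] 0) (𝓝 0) := by
    have h := ConformalLiouville.tendsto_norm_mul_fderiv (huC.contDiffAt (x := 0))
      EventuallyEq.rfl
    refine h.congr fun y => ?_
    rw [show ‖gradient u y‖ = ‖fderiv ℝ u y‖ from LinearIsometryEquiv.norm_map _ _]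
  obtain ⟨xbar, a, b, ha, hb, h⟩ := part2 u huC.contDiffOn (fun x _ => hpos x)
    ⟨1, one_pos, u, huC.continuous.continuousOn, fun x _ => hpos x, fun _ _ _ => rfl⟩
    hgrad (fun x _ => hsol x (mem_univ x)) hreg
  refine ⟨xbar, a, b, ha, hb, fun x => ?_⟩
  -- both sides are continuous, and the origin is not isolated
  have : Nonempty (Fin n) := ⟨⟨0, by omega⟩⟩
  have hc : Continuous fun x : EuclideanSpace ℝ (Fin n) =>
      (a / (1 + b ^ 2 * ‖x - xbar‖ ^ 2)) ^ (((n : ℝ) - 2) / 2) := by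
    have h1 : Continuous fun x : EuclideanSpace ℝ (Fin n) =>
        a / (1 + b ^ 2 * ‖x - xbar‖ ^ 2) :=
      Continuous.div (by fun_prop) (by fun_prop) fun x => by positivity
    exact h1.rpow_const fun x => Or.inl (by positivity)
  exact congrFun (huC.continuous.ext_on (dense_compl_singleton 0) hc fun x hx => h x hx) x
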